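/- Work in ZFC. For an ordinal $\mu$ and a regular cardinal $\kappa$ let $S^{\mu}_{\kappa}=\{\alpha<\mu:\operatorname{cf}(\alpha)=\kappa\}$. For a set $C$ of ordinals let $\operatorname{acc}(C)=\{\beta\in C:\beta=\sup(C\cap\beta)\}$ and $\operatorname{nacc}(C)=C\setminus\operatorname{acc}(C)$. A club of a limit ordinal $\delta$ is a closed unbounded subset of $\delta$. A set $S$ is stationary in $\delta$ if it meets every club of $\delta$; "stationary" without qualification means stationary in $\lambda^+$. **Theorem 1.1.** (1) Suppose that (a) $\lambda,\theta_1,\theta$ are infinite cardinals, $\lambda$ and $\theta$ are regular, $\lambda>\theta_1^+>\theta_1\ge\theta>\aleph_1$, and $\lambda\ge 2^{\aleph_0}$; (b) $S^*\subseteq S^{\lambda^+}_{\theta}$ is stationary and, moreover, the set $$S_1=\{\delta<\lambda^+:\operatorname{cf}(\delta)=\theta_1^+\text{ and }S^*\cap\delta\text{ is stationary in }\delta\}$$ is stationary. Then there are a stationary set $S'\subseteq S^*$ and a sequence $\langle E_\delta:\delta\in S'\rangle$ such that (i) for every $\delta\in S'$, $E_\delta$ is a club of $\delta$ of order type at most $\lambda^{\omega}\times\theta_1^+$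 (ordinal exponentiation and ordinal product, i.e. $\theta_1^+$ consecutive copies of the ordinal power $\lambda^\omega$); (ii) for every $A\subseteq S^{\lambda^+}_{\lambda}$ unbounded in $\lambda^+$, the set $\{\delta\in S':\delta=\sup(A\cap\operatorname{nacc}(E_\delta))\}$ is stationary. (2) If $S^*=S^{\lambda^+}_{\theta}$, then the assumption $\lambda\ge 2^{\aleph_0}$ in (1) can be omitted. -/

import Mathlib

open Cardinal Ordinal Set

universe u

namespace ClubGuess

/-- `C` is a club (closed unbounded subset) of the ordinal `δ`. Used only for limit `δ`, where
being cofinal in `δ` is the same as being unbounded in `δ`. -/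
def IsClubIn (C : Set Ordinal.{u}) (δ : Ordinal.{u}) : Prop :=
  C ⊆ Iio δ ∧ IsClub ((↑) ⁻¹' C : Set (Iio δ))

/-- `S ∩ δ` is stationary in the ordinal `δ`: it meets every club of `δ`. -/
def IsStationaryIn (S : Set Ordinal.{u}) (δ : Ordinal.{u}) : Prop :=
  IsStationary ((↑) ⁻¹' S : Set (Iio δ))

/-- `A` is an unbounded subset of the ordinal `δ`. -/
def IsUnboundedIn (A : Set Ordinal.{u}) (δ : Ordinal.{u}) : Prop :=
  A ⊆ Iio δ ∧ ∀ α < δ, ∃ β ∈ A, α < β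

/-- `S^δ_κ`, the set of ordinals below `δ` of cofinality `κ`. -/
def cofSet (δ : Ordinal.{u}) (κ : Cardinal.{u}) : Set Ordinal.{u} :=
  {α | α < δ ∧ α.cof = κ}

/-- The set of accumulation points of `C` lying in `C`. -/
def acc (C : Set Ordinal.{u}) : Set Ordinal.{u} :=
  {β | β ∈ C ∧ β = sSup (C ∩ Iio β)}

/-- The set of points of `C` that are not accumulation points of `C`. -/
def nacc (C : Set Ordinal.{u}) : Set Ordinal.{u} :=
  C \ acc C

/-- The order type of the set of ordinals `C` is at most `γ`. The order type of `C` lives one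
universe up, hence the lift. -/
def OtpLE (C : Set Ordinal.{u}) (γ : Ordinal.{u}) : Prop :=
  typeLT C ≤ Ordinal.lift.{u + 1} γ

/-- The set of `δ < μ` of cofinality `κ` in which `S` reflects, that is, `S ∩ δ` is stationary
in `δ`. -/
def reflectionSet (S : Set Ordinal.{u}) (μ : Ordinal.{u}) (κ : Cardinal.{u}) :
    Set Ordinal.{u} :=
  {δ | δ < μ ∧ δ.cof = κ ∧ IsStationaryIn S δ}

/-- There are a stationary `S' ⊆ S` and clubs `E δ` of `δ`, for `δ ∈ S'`, of order type at most
`γ`, such that every unbounded `A ⊆ S^{λ⁺}_λ` satisfies `δ = sup (A ∩ nacc (E δ))` for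
stationarily many `δ ∈ S'`. Here `l` is `λ`. -/
def HasGuessingClubs (l : Cardinal.{u}) (S : Set Ordinal.{u}) (γ : Ordinal.{u}) : Prop :=
  ∃ S' : Set Ordinal.{u}, S' ⊆ S ∧ IsStationaryIn S' (Order.succ l).ord ∧
    ∃ E : Ordinal.{u} → Set Ordinal.{u},
      (∀ δ ∈ S', IsClubIn (E δ) δ ∧ OtpLE (E δ) γ) ∧
      ∀ A : Set Ordinal.{u}, A ⊆ cofSet (Order.succ l).ord l →
        IsUnboundedIn A (Order.succ l).ord →
        IsStationaryIn {δ | δ ∈ S' ∧ δ = sSup (A ∩ nacc (E δ))} (Order.succ l).ord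

end ClubGuess

/-! Write λ for `l` and κ for θ₁⁺. For every ε < λ⁺ fix a listing `g ε` of ε in length λ. If δ has
uncountable cofinality below λ, some stage ν < λ is coherent for δ (`CoherentAt`): the first ν
listed elements are cofinal in δ, and the same stage ν at an element ε lists exactly the part below
ε. Starting from the closure of stage ν and repeatedly filling gaps with a ladder system gives clubs
`level g e δ ν n`, n < ω, with two virtues. They are local: at an ε in the coherent stage that is
also a limit of it, the level n of ε is the level n of δ cut at ε (`level_eq_inter`). They are
exhaustive: each x < δ of cofinality λ enters at some level n and is then not an accumulation point
of that level (`exists_mem_level_not_unbddAt`). So any A of points of cofinality λ that is unbounded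
in δ meets the non-accumulation points of one level n cofinally, because cf(δ) > ω. Each fill
multiplies the order type bound by λ, so every level stays below λ^ω.

The right n depends on A and δ. It is supplied by a colouring of S ∩ δ with ω colours, all
stationary in δ, computed from finitely many ordinals below δ: let E_ε be the level of ε whose
number is the colour of ε. If every choice of parameters failed, each would have a bad A and a bad
club. Diagonalise over all parameters to a reflection point δ, take the parameters that suit δ, let
n be the level capturing their A, and pick ε < δ of colour n in all relevant clubs. By locality E_ε
guesses A at ε, a contradiction (`hasGuessingClubs_of_coloring`).

The colourings split a stationary set by the values of one coordinate of cofinal maps θ → ε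
(`exists_splitting`). If λ ≥ 2^ℵ₀, the splitting ω-sequence is coded by its supremum and one ordinal
below λ. If S is the full set of cofinality θ, the coherent stage is collapsed onto an ordinal ζ < λ
by a rank that does not mention δ, a colouring of ζ fixed in advance is pulled back, and ζ is the
only further parameter. -/

namespace ClubGuess

/-! ### Clubs and stationary sets below an ordinal -/

/-- `A ∩ δ` is unbounded in `δ`. -/
def UnbddAt (A : Set Ordinal.{u}) (δ : Ordinal.{u}) : Prop :=
  ∀ y < δ, ∃ a ∈ A, y < a ∧ a < δ

/-- `A` contains its nonzero limit points below `δ`. -/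
def ClosedAt (A : Set Ordinal.{u}) (δ : Ordinal.{u}) : Prop :=
  ∀ x < δ, x ≠ 0 → UnbddAt A x → x ∈ A

/-- `A ∩ δ` is a club of `δ`. -/
def ClubAt (A : Set Ordinal.{u}) (δ : Ordinal.{u}) : Prop :=
  UnbddAt A δ ∧ ClosedAt A δ

/-- `A` meets every club of `δ`. -/
def StatAt (A : Set Ordinal.{u}) (δ : Ordinal.{u}) : Prop :=
  ∀ D : Set Ordinal.{u}, ClubAt D δ → ∃ x ∈ A, x < δ ∧ x ∈ D

theorem UnbddAt.mono {A B : Set Ordinal.{u}} {δ : Ordinal.{u}} (h : UnbddAt A δ) (hAB : A ⊆ B) :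
    UnbddAt B δ := fun y hy ↦
  let ⟨a, ha, h⟩ := h y hy; ⟨a, hAB ha, h⟩

theorem StatAt.mono {A B : Set Ordinal.{u}} {δ : Ordinal.{u}} (h : StatAt A δ) (hAB : A ⊆ B) :
    StatAt B δ := fun D hD ↦
  let ⟨a, ha, h⟩ := h D hD; ⟨a, hAB ha, h⟩

theorem isClub_of_clubAt {D : Set Ordinal.{u}} {δ : Ordinal.{u}} (h : ClubAt D δ) :
    IsClub ((↑) ⁻¹' D : Set (Iio δ)) := by
  refine ⟨?_, ?_⟩
  · rintro d hd ⟨z, hz⟩ - ⟨a, ha⟩ hlub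
    by_cases hmem : (⟨a, ha⟩ : Iio δ) ∈ d
    · exact hd hmem
    have hlt : ∀ w ∈ d, w < ⟨a, ha⟩ := fun w hw ↦
      lt_of_le_of_ne (hlub.1 hw) (fun h ↦ hmem (h ▸ hw))
    refine h.2 a ha ?_ ?_
    · rintro rfl
      exact not_lt_zero (a := z.1) (hlt z hz)
    · intro y hy
      by_contra! hcon
      have : (⟨a, ha⟩ : Iio δ) ≤ ⟨y, hy.trans ha⟩ := hlub.2 fun w hw ↦ by
        by_contra! hw'
        exact (hcon w (hd hw) hw').not_gt (hlt w hw)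
      exact this.not_gt hy
  · rintro ⟨y, hy⟩
    obtain ⟨a, ha, h1, h2⟩ := h.1 y hy
    exact ⟨⟨a, h2⟩, ha, h1.le⟩

theorem clubAt_of_isClub {δ : Ordinal.{u}} (hδ : Order.IsSuccLimit δ) {t : Set (Iio δ)}
    (h : IsClub t) : ClubAt ((↑) '' t) δ := by
  refine ⟨fun y hy ↦ ?_, fun x hx hx0 hU ↦ ?_⟩
  · obtain ⟨b, hb, h1⟩ := h.isCofinal ⟨Order.succ y, hδ.succ_lt hy⟩
    exact ⟨b, ⟨b, hb, rfl⟩, (Order.lt_succ y).trans_le h1, b.2⟩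
  · refine ⟨⟨x, hx⟩, ?_, rfl⟩
    refine h.isLUB_mem (t := {w | w ∈ t ∧ w.1 < x}) (fun w hw ↦ hw.1) ?_ ⟨fun w hw ↦ hw.2.le, ?_⟩
    · obtain ⟨_, ⟨b, hb, rfl⟩, h1, h2⟩ := hU 0 (pos_iff_ne_zero.2 hx0)
      exact ⟨b, hb, h2⟩
    · rintro ⟨y, hy⟩ hub
      by_contra! hlt
      obtain ⟨_, ⟨b, hb, rfl⟩, h1, h2⟩ := hU y hlt
      exact (hub ⟨hb, h2⟩ : b.1 ≤ y).not_gt h1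

theorem isStationaryIn_iff {A : Set Ordinal.{u}} {δ : Ordinal.{u}} (hδ : Order.IsSuccLimit δ) :
    IsStationaryIn A δ ↔ StatAt A δ := by
  constructor
  · intro h D hD
    obtain ⟨x, hx, hx'⟩ := h (isClub_of_clubAt hD)
    exact ⟨x, hx, x.2, hx'⟩
  · intro h t ht
    obtain ⟨x, hx, hxδ, ⟨b, hb, rfl⟩⟩ := h _ (clubAt_of_isClub hδ ht)
    exact ⟨b, hx, hb⟩

theorem exists_bound_set {δ : Ordinal.{u}} {T : Set Ordinal.{u}}
    (hT : #T < Cardinal.lift.{u + 1} δ.cof) (h : ∀ x ∈ T, x < δ) : ∃ y < δ, ∀ x ∈ T, x ≤ y := by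
  refine ⟨sSup T, sSup_lt_of_lt_cof (by rwa [← lift_cof]) h, fun x hx ↦ le_csSup ⟨δ, ?_⟩ hx⟩
  exact fun x hx ↦ (h x hx).le

theorem exists_bound_fun {δ : Ordinal.{u}} {ι : Type (u + 1)} (f : ι → Ordinal.{u})
    (hT : #ι < Cardinal.lift.{u + 1} δ.cof) (h : ∀ i, f i < δ) : ∃ y < δ, ∀ i, f i ≤ y := by
  obtain ⟨y, hy, hy'⟩ := exists_bound_set (T := range f) (mk_range_le.trans_lt hT)
    (by rintro _ ⟨i, rfl⟩; exact h i)
  exact ⟨y, hy, fun i ↦ hy' _ ⟨i, rfl⟩⟩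

theorem exists_bound_Iio {δ o : Ordinal.{u}} (f : Ordinal.{u} → Ordinal.{u})
    (hT : o.card < δ.cof) (h : ∀ i < o, f i < δ) : ∃ y < δ, ∀ i < o, f i ≤ y := by
  obtain ⟨y, hy, hy'⟩ := exists_bound_fun (ι := Iio o) (fun i ↦ f i)
    (by rw [Cardinal.mk_Iio_ordinal]; exact Cardinal.lift_lt.2 hT) (fun i ↦ h i i.2)
  exact ⟨y, hy, fun i hi ↦ hy' ⟨i, hi⟩⟩

theorem exists_bound_nat {δ : Ordinal.{u}} (f : ℕ → Ordinal.{u})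
    (hT : ℵ₀ < δ.cof) (h : ∀ i, f i < δ) : ∃ y < δ, ∀ i, f i ≤ y := by
  obtain ⟨y, hy, hy'⟩ := exists_bound_fun (ι := ULift.{u + 1} ℕ) (fun i ↦ f i.down)
    (by simpa only [mk_uLift, mk_nat, lift_aleph0] using aleph0_lt_lift.2 hT) (fun i ↦ h _)
  exact ⟨y, hy, fun i ↦ hy' ⟨i⟩⟩

/-- The engine of all closing-off arguments below: iterate a choice function for `R` and take the
supremum, which stays below δ since cf(δ) > ω. -/
theorem exists_omega_chain {δ : Ordinal.{u}} (hδ : ℵ₀ < δ.cof)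
    {R : Ordinal.{u} → Ordinal.{u} → Prop} (hR : ∀ y < δ, ∃ z < δ, y < z ∧ R y z)
    {y₀ : Ordinal.{u}} (hy₀ : y₀ < δ) :
    ∃ f : ℕ → Ordinal.{u}, f 0 = y₀ ∧ StrictMono f ∧ (∀ n, f n < δ) ∧
      (∀ n, R (f n) (f (n + 1))) ∧
      ∃ x < δ, (∀ n, f n < x) ∧ ∀ y < x, ∃ n, y < f n := by
  choose! F hF1 hF2 hF3 using hR
  let f : ℕ → Ordinal.{u} := fun n ↦ F^[n] y₀
  have hs : ∀ n, f (n + 1) = F (f n) := fun n ↦ Function.iterate_succ_apply' F n y₀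
  have hlt : ∀ n, f n < δ := by
    intro n
    induction n with
    | zero => exact hy₀
    | succ n ih => rw [hs]; exact hF1 _ ih
  have hmono : StrictMono f := strictMono_nat_of_lt_succ fun n ↦ by
    rw [hs]; exact hF2 _ (hlt n)
  obtain ⟨b, hb, hb'⟩ := exists_bound_nat f hδ hlt
  have hbdd : BddAbove (range f) := ⟨b, by rintro _ ⟨n, rfl⟩; exact hb' n⟩
  refine ⟨f, rfl, hmono, hlt, fun n ↦ by rw [hs]; exact hF3 _ (hlt n), ⨆ n, f n,
    (ciSup_le hb').trans_lt hb, fun n ↦ ?_, fun y hy ↦ ?_⟩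
  · exact (hmono n.lt_succ_self).trans_le (le_ciSup hbdd (n + 1))
  · exact exists_lt_of_lt_ciSup hy

theorem isSuccLimit_of_aleph0_lt_cof {δ : Ordinal.{u}} (hδ : ℵ₀ < δ.cof) : Order.IsSuccLimit δ :=
  one_lt_cof_iff.1 (one_lt_aleph0.trans hδ)

theorem clubAt_setOf_unbddAt {δ : Ordinal.{u}} (hδ : ℵ₀ < δ.cof) {W : Set Ordinal.{u}}
    (hW : UnbddAt W δ) : ClubAt {x | UnbddAt W x} δ := by
  refine ⟨fun y hy ↦ ?_, fun x hx hx0 h y hy ↦ ?_⟩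
  · obtain ⟨f, h0, hm, -, hR, x, hx, hfx, hxf⟩ := exists_omega_chain hδ
      (R := fun y z ↦ ∃ w ∈ W, y < w ∧ w < z) (fun y hy ↦ by
        obtain ⟨w, hw, h1, h2⟩ := hW y hy
        obtain ⟨v, hv, h3, h4⟩ := hW w h2
        exact ⟨v, h4, h1.trans h3, w, hw, h1, h3⟩) hy
    refine ⟨x, fun z hz ↦ ?_, h0 ▸ hfx 0, hx⟩
    obtain ⟨n, hn⟩ := hxf z hz
    obtain ⟨w, hw, h1, h2⟩ := hR n
    exact ⟨w, hw, hn.trans h1, h2.trans (hfx _)⟩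
  · obtain ⟨a, ha, h1, h2⟩ := h y hy
    obtain ⟨b, hb, h3, h4⟩ := ha y h1
    exact ⟨b, hb, h3, h4.trans h2⟩

/-- A diagonal intersection in which the club `D i` becomes active only above `r i`. Constant `r`
gives intersections of fewer than cf(δ) clubs. -/
theorem clubAt_diagonal {δ : Ordinal.{u}} (hδ : ℵ₀ < δ.cof) {ι : Type (u + 1)}
    (r : ι → Ordinal.{u}) (D : ι → Set Ordinal.{u})
    (hr : ∀ x < δ, #{i | r i < x} < Cardinal.lift.{u + 1} δ.cof) (hD : ∀ i, ClubAt (D i) δ) :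
    ClubAt {x | ∀ i, r i < x → x ∈ D i} δ := by
  refine ⟨fun y hy ↦ ?_, fun x hx hx0 h i hi ↦ ?_⟩
  · obtain ⟨f, h0, hm, -, hR, x, hx, hfx, hxf⟩ := exists_omega_chain hδ
      (R := fun y z ↦ ∀ i, r i < y → ∃ d ∈ D i, y < d ∧ d < z) (fun y hy ↦ by
        choose d hd using fun i ↦ (hD i).1 y hy
        obtain ⟨z, hz, hz'⟩ := exists_bound_fun (ι := {i | r i < y}) (fun i ↦ d i)
          (hr y hy) (fun i ↦ (hd i).2.2)
        have hlim := (isSuccLimit_of_aleph0_lt_cof hδ)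
        refine ⟨Order.succ (max y z), hlim.succ_lt (max_lt hy hz),
          Order.lt_succ_of_le (le_max_left _ _), fun i hi ↦ ⟨d i, (hd i).1, (hd i).2.1, ?_⟩⟩
        exact Order.lt_succ_of_le ((hz' ⟨i, hi⟩).trans (le_max_right _ _))) hy
    refine ⟨x, fun i hi ↦ ?_, h0 ▸ hfx 0, hx⟩
    refine (hD i).2 x hx (fun h ↦ not_lt_zero (h ▸ hi)) fun z hz ↦ ?_
    obtain ⟨n, hn⟩ := hxf _ (max_lt hz hi)
    obtain ⟨d, hd, h1, h2⟩ := hR n i ((le_max_right _ _).trans_lt hn)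
    exact ⟨d, hd, ((le_max_left _ _).trans_lt hn).trans h1, h2.trans (hfx _)⟩
  · refine (hD i).2 x hx hx0 fun z hz ↦ ?_
    obtain ⟨w, hw, h1, h2⟩ := h _ (max_lt hz hi)
    exact ⟨w, hw i ((le_max_right _ _).trans_lt h1), (le_max_left _ _).trans_lt h1, h2⟩

theorem ClubAt.inter {δ : Ordinal.{u}} (hδ : ℵ₀ < δ.cof) {C D : Set Ordinal.{u}}
    (hC : ClubAt C δ) (hD : ClubAt D δ) : ClubAt {x | 0 < x ∧ x ∈ C ∧ x ∈ D} δ := by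
  have h := clubAt_diagonal hδ (ι := ULift.{u + 1} Bool) (fun _ ↦ 0)
    (fun i ↦ if i.down then C else D)
    (fun x hx ↦ (mk_set_le _).trans_lt (by
      have : #(ULift.{u + 1} Bool) < ℵ₀ := Cardinal.lt_aleph0_of_finite _
      exact this.trans (aleph0_lt_lift.2 hδ)))
    (by rintro ⟨_ | _⟩ <;> simpa)
  refine ⟨fun y hy ↦ ?_, fun x hx hx0 hU ↦ ⟨pos_iff_ne_zero.2 hx0,
    hC.2 x hx hx0 (hU.mono fun z hz ↦ hz.2.1), hD.2 x hx hx0 (hU.mono fun z hz ↦ hz.2.2)⟩⟩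
  obtain ⟨a, ha, h1, h2⟩ := h.1 y hy
  have h0 : 0 < a := zero_le.trans_lt h1
  exact ⟨a, ⟨h0, by simpa using ha ⟨true⟩ h0, by simpa using ha ⟨false⟩ h0⟩, h1, h2⟩

theorem not_statAt_iff {A : Set Ordinal.{u}} {δ : Ordinal.{u}} :
    ¬ StatAt A δ ↔ ∃ D, ClubAt D δ ∧ ∀ x ∈ A, x < δ → x ∉ D := by
  simp [StatAt]

theorem clubAt_Ioi {δ y : Ordinal.{u}} (hδ : Order.IsSuccLimit δ) (hy : y < δ) :
    ClubAt (Ioi y) δ := by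
  refine ⟨fun z hz ↦ ⟨Order.succ (max y z), Order.lt_succ_iff.2 (le_max_left y z),
    Order.lt_succ_of_le (le_max_right _ _), hδ.succ_lt (max_lt hy hz)⟩, fun x _ hx0 h ↦ ?_⟩
  obtain ⟨a, ha, -, h2⟩ := h 0 (pos_iff_ne_zero.2 hx0)
  exact lt_trans ha h2

theorem StatAt.unbddAt {δ : Ordinal.{u}} (hδ : Order.IsSuccLimit δ) {A : Set Ordinal.{u}}
    (hA : StatAt A δ) : UnbddAt A δ := fun _ hy ↦
  let ⟨x, hx, hxδ, hxy⟩ := hA _ (clubAt_Ioi hδ hy)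
  ⟨x, hx, hxy, hxδ⟩

/-! ### Listings and coherent stages -/

section

theorem exists_unbddAt_mk_eq {δ : Ordinal.{u}} (hδ : Order.IsSuccLimit δ) :
    ∃ T : Set Ordinal.{u}, (∀ x ∈ T, x < δ) ∧ #T = Cardinal.lift.{u + 1} δ.cof ∧ UnbddAt T δ := by
  obtain ⟨s, hs, hcard⟩ := Order.exists_cof_eq (Iio δ)
  refine ⟨(↑) '' s, ?_, ?_, fun y hy ↦ ?_⟩
  · rintro _ ⟨x, -, rfl⟩
    exact x.2
  · rw [mk_image_eq Subtype.val_injective, hcard, cof_Iio, lift_cof]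
  · obtain ⟨b, hb, h1⟩ := hs ⟨Order.succ y, hδ.succ_lt hy⟩
    exact ⟨b, ⟨b, hb, rfl⟩, (Order.lt_succ y).trans_le h1, b.2⟩

/-- The next element of `A` at or above a limit point determines it, so limit points can be named by
elements of `A`. This bounds the size of closures and lets limit points be absorbed in fewer than λ
steps. -/
theorem UnbddAt.exists_sSup_inter_eq {A : Set Ordinal.{u}} {x : Ordinal.{u}} (h : UnbddAt A x)
    (hne : (A ∩ Ici x).Nonempty) : ∃ b ∈ A, sSup (A ∩ Iio b) = x := by
  obtain ⟨hb1, hb2⟩ := csInf_mem hne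
  refine ⟨_, hb1, ?_⟩
  have heq : A ∩ Iio (sInf (A ∩ Ici x)) = A ∩ Iio x := by
    ext y
    refine and_congr_right fun hy ↦ ⟨fun hyb ↦ ?_, fun hyx ↦ mem_Iio.2 (hyx.out.trans_le hb2)⟩
    by_contra hyx
    exact hyb.out.not_ge (csInf_le' ⟨hy, mem_Ici.2 (not_lt.1 hyx)⟩)
  rw [heq]
  refine le_antisymm (csSup_le' fun y hy ↦ hy.2.le) (le_of_forall_lt fun y hy ↦ ?_)
  obtain ⟨a, ha, h1, h2⟩ := h y hy
  exact h1.trans_le (le_csSup ⟨x, fun z hz ↦ hz.2.le⟩ ⟨ha, h2⟩)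

/-- The set of ordinals below `ε` listed by `g ε` before stage `ν`. -/
def listed (g : Ordinal.{u} → Ordinal.{u} → Ordinal.{u}) (ε ν : Ordinal.{u}) : Set Ordinal.{u} :=
  {β | β < ε ∧ ∃ i < ν, g ε i = β}

/-- The stage `ν` of the listing of `δ` coheres with the listings of its elements, is unbounded
in `δ` and contains its limit points of uncountable cofinality. -/
structure CoherentAt (g : Ordinal.{u} → Ordinal.{u} → Ordinal.{u}) (δ ν : Ordinal.{u}) : Prop where
  unbddAt : UnbddAt (listed g δ ν) δ
  eq_inter : ∀ ε ∈ listed g δ ν, listed g ε ν = listed g δ ν ∩ Iio ε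
  mem_of_unbddAt : ∀ ε < δ, ℵ₀ < ε.cof → UnbddAt (listed g δ ν) ε → ε ∈ listed g δ ν

variable {g : Ordinal.{u} → Ordinal.{u} → Ordinal.{u}}

theorem listed_mono {ε ν ν' : Ordinal.{u}} (h : ν ≤ ν') : listed g ε ν ⊆ listed g ε ν' :=
  fun _ ⟨hβ, i, hi, h'⟩ ↦ ⟨hβ, i, hi.trans_le h, h'⟩

theorem mk_listed_lt {l : Cardinal.{u}} {ε ν : Ordinal.{u}} (hν : ν < l.ord) :
    #(listed g ε ν) < Cardinal.lift.{u + 1} l := by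
  have h : listed g ε ν ⊆ range (fun i : Iio ν ↦ g ε i) := fun β ⟨_, i, hi, h⟩ ↦ ⟨⟨i, hi⟩, h⟩
  refine (mk_le_mk_of_subset h).trans_lt (mk_range_le.trans_lt ?_)
  rw [Cardinal.mk_Iio_ordinal, Cardinal.lift_lt]
  exact lt_ord.1 hν

theorem exists_subset_listed {l : Cardinal.{u}} (hl : l.IsRegular) {ε : Ordinal.{u}}
    (hg : ∀ β < ε, ∃ i < l.ord, g ε i = β) {T : Set Ordinal.{u}} (hT : ∀ x ∈ T, x < ε)
    (hcard : #T < Cardinal.lift.{u + 1} l) : ∃ ν < l.ord, T ⊆ listed g ε ν := by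
  choose! i hi hgi using hg
  obtain ⟨y, hy, hy'⟩ := exists_bound_fun (δ := l.ord) (fun x : T ↦ i x)
    (by rwa [hl.cof_ord]) (fun x ↦ hi _ (hT x x.2))
  refine ⟨Order.succ y, (isSuccLimit_ord hl.1).succ_lt hy, fun x hx ↦ ⟨hT x hx, i x, ?_, ?_⟩⟩
  · exact Order.lt_succ_of_le (hy' ⟨x, hx⟩)
  · exact hgi x (hT x hx)

/-- Each stage and its demands have fewer than λ elements, so by regularity a later stage meets them
all; the limit of ω such steps is coherent. -/
theorem exists_coherentAt {l : Cardinal.{u}} (hl : l.IsRegular) {δ : Ordinal.{u}}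
    (hg : ∀ ε ≤ δ, ∀ β < ε, ∃ i < l.ord, g ε i = β) (hδ : ℵ₀ < δ.cof) (hδl : δ.cof < l) :
    ∃ ν < l.ord, CoherentAt g δ ν := by
  have hlim := isSuccLimit_of_aleph0_lt_cof hδ
  have hlo : ℵ₀ < l.ord.cof := by rw [hl.cof_ord]; exact hδ.trans hδl
  have hllim := isSuccLimit_of_aleph0_lt_cof hlo
  obtain ⟨T, hT, hTc, hTu⟩ := exists_unbddAt_mk_eq hlim
  obtain ⟨ν₀, hν₀, hTν⟩ := exists_subset_listed hl (hg δ le_rfl) hT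
    (by rw [hTc]; exact Cardinal.lift_lt.2 hδl)
  obtain ⟨f, h0, hm, hfl, hR, ν, hν, hfν, hνf⟩ := exists_omega_chain hlo
    (R := fun y z ↦ (∀ ε ∈ listed g δ y, listed g ε y ⊆ listed g δ z ∧
        listed g δ y ∩ Iio ε ⊆ listed g ε z) ∧
      ∀ b ∈ listed g δ y, sSup (listed g δ y ∩ Iio b) ∈ listed g δ z) (fun y hy ↦ by
    have h1 : ∀ ε : listed g δ y, ∃ z < l.ord, listed g ε y ⊆ listed g δ z := fun ε ↦
      exists_subset_listed hl (hg δ le_rfl) (fun x hx ↦ hx.1.trans ε.2.1) (mk_listed_lt hy)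
    have h2 : ∀ ε : listed g δ y, ∃ z < l.ord, listed g δ y ∩ Iio ε.1 ⊆ listed g ε z := fun ε ↦
      exists_subset_listed hl (hg ε ε.2.1.le) (fun x hx ↦ hx.2)
        ((mk_le_mk_of_subset inter_subset_left).trans_lt (mk_listed_lt hy))
    obtain ⟨z₃, hz₃, h3⟩ := exists_subset_listed hl (hg δ le_rfl)
      (T := (fun b ↦ sSup (listed g δ y ∩ Iio b)) '' listed g δ y) (by
        rintro _ ⟨b, hb, rfl⟩
        exact (csSup_le' fun x hx ↦ hx.2.le).trans_lt hb.1) (mk_image_le.trans_lt (mk_listed_lt hy))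
    choose F hF hF' using h1
    choose G hG hG' using h2
    have hc : #(listed g δ y) < Cardinal.lift.{u + 1} l.ord.cof := by
      rw [hl.cof_ord]; exact mk_listed_lt hy
    obtain ⟨z₁, hz₁, hz₁'⟩ := exists_bound_fun F hc hF
    obtain ⟨z₂, hz₂, hz₂'⟩ := exists_bound_fun G hc hG
    refine ⟨max (Order.succ y) (max z₁ (max z₂ z₃)),
      max_lt (hllim.succ_lt hy) (max_lt hz₁ (max_lt hz₂ hz₃)),
      (Order.lt_succ y).trans_le (le_max_left _ _), fun ε hε ↦ ⟨?_, ?_⟩, fun b hb ↦ ?_⟩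
    · exact (hF' ⟨ε, hε⟩).trans (listed_mono ((hz₁' _).trans (by simp)))
    · exact (hG' ⟨ε, hε⟩).trans (listed_mono ((hz₂' _).trans (by simp)))
    · exact listed_mono (by simp) (h3 ⟨b, hb, rfl⟩)) hν₀
  have hmem : ∀ ε β, β ∈ listed g ε ν → ∃ n, β ∈ listed g ε (f n) := by
    rintro ε β ⟨hβ, i, hi, h⟩
    obtain ⟨n, hn⟩ := hνf i hi
    exact ⟨n, hβ, i, hn, h⟩
  have hle : ∀ n ε, listed g ε (f n) ⊆ listed g ε ν := fun n ε ↦ listed_mono (hfν n).le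
  have hmono : ∀ {m n} ε, m ≤ n → listed g ε (f m) ⊆ listed g ε (f n) := fun ε h ↦
    listed_mono (hm.monotone h)
  have hU0 : UnbddAt (listed g δ (f 0)) δ := hTu.mono (h0 ▸ hTν)
  refine ⟨ν, hν, hU0.mono (hle 0 δ), fun ε hε ↦ ?_, fun ε hε hcof hU ↦ ?_⟩
  · obtain ⟨n, hn⟩ := hmem _ _ hε
    refine Subset.antisymm (fun β hβ ↦ ?_) (fun β hβ ↦ ?_)
    · obtain ⟨m, hm'⟩ := hmem _ _ hβ
      refine ⟨hle (max m n + 1) _ ?_, hβ.1⟩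
      exact ((hR (max m n)).1 ε (hmono _ (le_max_right _ _) hn)).1 (hmono _ (le_max_left _ _) hm')
    · obtain ⟨m, hm'⟩ := hmem _ _ hβ.1
      refine hle (max m n + 1) _ ?_
      exact ((hR (max m n)).1 ε (hmono _ (le_max_right _ _) hn)).2
        ⟨hmono _ (le_max_left _ _) hm', hβ.2⟩
  -- Since cf(ε) > ω, a limit point of the union of ω stages is already a limit point of one of
  -- them, and the next stage contains it.
  · have hn : ∃ n, UnbddAt (listed g δ (f n)) ε := by
      by_contra! hcon
      simp only [UnbddAt, not_forall] at hcon
      choose y hy hy' using hcon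
      obtain ⟨z, hz, hz'⟩ := exists_bound_nat y hcof hy
      obtain ⟨a, ha, h1, h2⟩ := hU z hz
      obtain ⟨n, hn⟩ := hmem _ _ ha
      exact hy' n ⟨a, hn, (hz' n).trans_lt h1, h2⟩
    obtain ⟨n, hn⟩ := hn
    obtain ⟨a, ha, h1, h2⟩ := hU0 ε hε
    obtain ⟨b, hb, hbε⟩ := hn.exists_sSup_inter_eq ⟨a, hmono _ (Nat.zero_le _) ha, h1.le⟩
    exact hle (n + 1) _ (hbε ▸ (hR n).2 b hb)

end

/-! ### Ladder systems and filling gaps -/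

section

/-- A ladder system below `L`: `e β` is a closed subset of `β` that is cofinal in `β`, ranked by
`ρ β` in order type at most `l`. -/
structure IsLadder (l : Cardinal.{u}) (L : Ordinal.{u}) (e : Ordinal.{u} → Set Ordinal.{u})
    (ρ : Ordinal.{u} → Ordinal.{u} → Ordinal.{u}) : Prop where
  closedAt : ∀ β < L, ClosedAt (e β) β
  cofinal : ∀ β < L, ∀ α < β, ∃ x ∈ e β, α ≤ x ∧ x < β
  strictMonoOn : ∀ β < L, StrictMonoOn (ρ β) (e β)
  rank_lt : ∀ β < L, ∀ x ∈ e β, ρ β x < l.ord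

theorem not_unbddAt_of_mk_lt {A : Set Ordinal.{u}} {α : Ordinal.{u}}
    (hA : #(A ∩ Iio α : Set _) < Cardinal.lift.{u + 1} α.cof) : ¬ UnbddAt A α := by
  intro h
  obtain ⟨y, hy, hy'⟩ := exists_bound_set hA fun x hx ↦ hx.2
  obtain ⟨a, ha, h1, h2⟩ := h y hy
  exact (hy' a ⟨ha, h2⟩).not_gt h1

/-- Some point of `e β` lies at or above α, and its rank is below λ; so fewer than λ points of `e β`
lie below α. -/
theorem IsLadder.not_unbddAt {l : Cardinal.{u}} {L : Ordinal.{u}}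
    {e : Ordinal.{u} → Set Ordinal.{u}} {ρ : Ordinal.{u} → Ordinal.{u} → Ordinal.{u}}
    (h : IsLadder l L e ρ) {α β : Ordinal.{u}} (hαβ : α < β) (hβ : β < L)
    (hα : α.cof = l) : ¬ UnbddAt (e β) α := by
  obtain ⟨x, hx, hαx, -⟩ := h.cofinal β hβ α hαβ
  refine not_unbddAt_of_mk_lt ?_
  have hinj : Function.Injective (fun y : (e β ∩ Iio α : Set _) ↦
      (⟨ρ β y, h.strictMonoOn β hβ y.2.1 hx (y.2.2.out.trans_le hαx)⟩ : Iio (ρ β x))) := by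
    rintro ⟨y, hy⟩ ⟨z, hz⟩ hyz
    exact Subtype.ext ((h.strictMonoOn β hβ).injOn hy.1 hz.1 (Subtype.ext_iff.1 hyz))
  refine (mk_le_of_injective hinj).trans_lt ?_
  rw [Cardinal.mk_Iio_ordinal, Cardinal.lift_lt, hα]
  exact lt_ord.1 (h.rank_lt β hβ x hx)

/-- Take the closure of a fundamental sequence and rank x by the first index whose value exceeds x.
Ranks increase strictly, because a point x' > x of the closure forces a value of the sequence in (x,
x']. -/
theorem exists_ladder {l : Cardinal.{u}} (hl : ℵ₀ ≤ l) {β : Ordinal.{u}} (hβ : β.cof ≤ l) :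
    ∃ (s : Set Ordinal.{u}) (r : Ordinal.{u} → Ordinal.{u}), ClosedAt s β ∧
      (∀ α < β, ∃ x ∈ s, α ≤ x ∧ x < β) ∧ StrictMonoOn r s ∧ ∀ x ∈ s, r x < l.ord := by
  have hl0 : 0 < l.ord := by simpa using (aleph0_pos.trans_le hl)
  rcases zero_or_succ_or_isSuccLimit β with rfl | ⟨γ, rfl⟩ | hlim
  · exact ⟨∅, id, fun x hx ↦ (not_lt_zero hx).elim, fun x hx ↦ (not_lt_zero hx).elim, fun x hx ↦ hx.elim,
      fun x hx ↦ hx.elim⟩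
  · refine ⟨{γ}, fun _ ↦ 0, fun x hx hx0 h ↦ ?_, fun α hα ↦ ⟨γ, rfl, Order.lt_succ_iff.1 hα,
      Order.lt_succ γ⟩, by simp, fun _ _ ↦ hl0⟩
    obtain ⟨a, rfl, -, h2⟩ := h 0 (pos_iff_ne_zero.2 hx0)
    exact (h2.not_ge (Order.lt_succ_iff.1 hx)).elim
  · obtain ⟨f, hf⟩ := exists_isFundamentalSeq (o := β) rfl
    set R : Set Ordinal.{u} := range fun i ↦ (f i : Ordinal.{u}) with hR
    have hRu : ∀ y < β, ∃ i, y < f i := fun y hy ↦ by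
      obtain ⟨_, ⟨i, rfl⟩, hi⟩ := hf.isCofinal_range ⟨Order.succ y, hlim.succ_lt hy⟩
      exact ⟨i, (Order.lt_succ y).trans_le hi⟩
    let s : Set Ordinal.{u} := {x | x < β ∧ (x ∈ R ∨ UnbddAt R x)}
    let P : Ordinal.{u} → Set Ordinal.{u} := fun x ↦ {i | ∃ h : i < β.cof.ord, x < f ⟨i, h⟩}
    have hP : ∀ x < β, (P x).Nonempty := fun x hx ↦
      let ⟨i, hi⟩ := hRu x hx; ⟨i, i.2, hi⟩
    have hPm : ∀ x < β, sInf (P x) ∈ P x := fun x hx ↦ csInf_mem (hP x hx)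
    refine ⟨s, fun x ↦ sInf (P x), fun x hx hx0 h ↦ ⟨hx, Or.inr fun y hy ↦ ?_⟩, fun α hα ↦ ?_,
      fun x hx x' hx' hxx' ↦ ?_, fun x hx ↦ ?_⟩
    · obtain ⟨a, ha, h1, h2⟩ := h y hy
      rcases ha.2 with ha' | ha'
      · exact ⟨a, ha', h1, h2⟩
      · obtain ⟨b, hb, h3, h4⟩ := ha' y h1
        exact ⟨b, hb, h3, h4.trans h2⟩
    · obtain ⟨i, hi⟩ := hRu α hα
      exact ⟨f i, ⟨(f i).2, Or.inl ⟨i, rfl⟩⟩, hi.le, (f i).2⟩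
    · obtain ⟨hi', hxi'⟩ := hPm x' hx'.1
      refine lt_of_le_of_ne (csInf_le' ⟨hi', hxx'.trans hxi'⟩) fun heq ↦ ?_
      have key : ∀ j, f j ≤ x ∨ x' < f j := fun j ↦ by
        rcases le_or_gt (sInf (P x')) j with hj | hj
        · exact Or.inr (hxi'.trans_le (hf.strictMono.monotone (a := ⟨_, hi'⟩) hj))
        · refine Or.inl (not_lt.1 fun hlt ↦ ?_)
          have hjP : j.1 ∈ P x := ⟨j.2, hlt⟩
          exact (csInf_le' hjP).not_gt (hj.trans_eq heq.symm)
      rcases hx'.2 with ⟨j, hj⟩ | hU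
      · rcases key j with h | h
        · exact (h.trans_lt hxx').ne hj
        · exact h.ne hj.symm
      · obtain ⟨_, ⟨j, rfl⟩, h1, h2⟩ := hU x hxx'
        rcases key j with h | h
        · exact h.not_gt h1
        · exact h.not_gt h2
    · exact (hPm x hx.1).1.trans_le (ord_le_ord.2 hβ)

theorem exists_isLadder {l : Cardinal.{u}} (hl : ℵ₀ ≤ l) :
    ∃ e ρ, IsLadder l (Order.succ l).ord e ρ := by
  have h : ∀ β : Ordinal.{u}, ∃ (s : Set Ordinal.{u}) (r : Ordinal.{u} → Ordinal.{u}),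
      β < (Order.succ l).ord → ClosedAt s β ∧
      (∀ α < β, ∃ x ∈ s, α ≤ x ∧ x < β) ∧ StrictMonoOn r s ∧ ∀ x ∈ s, r x < l.ord := by
    intro β
    by_cases hβ : β < (Order.succ l).ord
    · obtain ⟨s, r, h⟩ := exists_ladder hl
        ((cof_le_card β).trans (Order.lt_succ_iff.1 (lt_ord.1 hβ)))
      exact ⟨s, r, fun _ ↦ h⟩
    · exact ⟨∅, id, fun h ↦ (hβ h).elim⟩
  choose e ρ h using h
  exact ⟨e, ρ, fun β hβ ↦ (h β hβ).1, fun β hβ ↦ (h β hβ).2.1, fun β hβ ↦ (h β hβ).2.2.1,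
    fun β hβ ↦ (h β hβ).2.2.2⟩

/-- Between consecutive points `γ < β` of `C`, insert the part of `e β` above `γ`. -/
def fill (e : Ordinal.{u} → Set Ordinal.{u}) (C : Set Ordinal.{u}) : Set Ordinal.{u} :=
  C ∪ {x | ∃ β ∈ C, x ∈ e β ∧ x < β ∧ ∃ γ ∈ C, γ < x ∧ ∀ c ∈ C, c ≤ γ ∨ β ≤ c}

variable {l : Cardinal.{u}} {L : Ordinal.{u}} {e : Ordinal.{u} → Set Ordinal.{u}}
  {ρ : Ordinal.{u} → Ordinal.{u} → Ordinal.{u}}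

/-- Filling is local: if ε is a limit of `C`, the gap around any x < ε closes before ε. -/
theorem fill_inter_Iio {C : Set Ordinal.{u}} {ε : Ordinal.{u}} (hε : UnbddAt C ε) :
    fill e (C ∩ Iio ε) = fill e C ∩ Iio ε := by
  ext x
  constructor
  · rintro (hx | ⟨β, hβ, hxβ, hlt, γ, hγ, hγx, h⟩)
    · exact ⟨Or.inl hx.1, hx.2⟩
    · refine ⟨Or.inr ⟨β, hβ.1, hxβ, hlt, γ, hγ.1, hγx, fun c hc ↦ ?_⟩, hlt.trans hβ.2⟩
      rcases lt_or_ge c ε with hcε | hcε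
      · exact h c ⟨hc, hcε⟩
      · exact Or.inr (hβ.2.out.le.trans hcε)
  · rintro ⟨hx | ⟨β, hβ, hxβ, hlt, γ, hγ, hγx, h⟩, hxε⟩
    · exact Or.inl ⟨hx, hxε⟩
    · obtain ⟨c, hc, h1, h2⟩ := hε x hxε
      have hβc : β ≤ c := (h c hc).resolve_left (hγx.trans h1).not_ge
      exact Or.inr ⟨β, ⟨hβ, hβc.trans_lt h2⟩, hxβ, hlt, γ, ⟨hγ, hγx.trans hxε⟩, hγx,
        fun c hc ↦ h c hc.1⟩

/-- `C` is a closed unbounded subset of `δ` containing `0`. -/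
structure IsBasedClub (C : Set Ordinal.{u}) (δ : Ordinal.{u}) : Prop where
  subset : C ⊆ Iio δ
  zero_mem : 0 ∈ C
  clubAt : ClubAt C δ

/-- Every point missed by a based club lies between two consecutive points of it. -/
theorem IsBasedClub.exists_gap {C : Set Ordinal.{u}} {δ : Ordinal.{u}} (hC : IsBasedClub C δ)
    {x : Ordinal.{u}} (hx : x < δ) (hxC : x ∉ C) :
    ∃ γ ∈ C, ∃ β ∈ C, γ < x ∧ x < β ∧ ∀ c ∈ C, c ≤ γ ∨ β ≤ c := by
  have hx0 : x ≠ 0 := fun h ↦ hxC (h ▸ hC.zero_mem)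
  have hx0' : 0 < x := pos_iff_ne_zero.2 hx0
  have hne : (C ∩ Ici x).Nonempty := by
    obtain ⟨a, ha, h1, -⟩ := hC.clubAt.1 x hx
    exact ⟨a, ha, h1.le⟩
  obtain ⟨hβ, hxβ⟩ := csInf_mem hne
  have hbdd : BddAbove (C ∩ Iio x) := ⟨x, fun y hy ↦ hy.2.le⟩
  have hsx : sSup (C ∩ Iio x) ≤ x := csSup_le' fun y hy ↦ hy.2.le
  have hsC : sSup (C ∩ Iio x) ∈ C := by
    by_contra hs
    refine hs (hC.clubAt.2 _ (hsx.trans_lt hx) ?_ fun y hy ↦ ?_)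
    · intro h
      exact hs (h ▸ hC.zero_mem)
    · obtain ⟨a, ha, h1⟩ := exists_lt_of_lt_csSup (s := C ∩ Iio x) ⟨0, hC.zero_mem, hx0'⟩ hy
      exact ⟨a, ha.1, h1, lt_of_le_of_ne (le_csSup hbdd ha) fun h ↦ hs (h ▸ ha.1)⟩
  refine ⟨_, hsC, _, hβ, lt_of_le_of_ne hsx fun h ↦ hxC (h ▸ hsC),
    lt_of_le_of_ne hxβ fun h ↦ hxC (h ▸ hβ), fun c hc ↦ ?_⟩
  rcases lt_or_ge c x with h | h
  · exact Or.inl (le_csSup hbdd ⟨hc, h⟩)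
  · exact Or.inr (csInf_le' ⟨hc, mem_Ici.2 h⟩)

theorem subset_fill {C : Set Ordinal.{u}} : C ⊆ fill e C := subset_union_left

/-- A limit point outside `C` sits in one gap of `C`, where the filling is a piece of a single
closed ladder. -/
theorem IsBasedClub.fill {C : Set Ordinal.{u}} {δ : Ordinal.{u}} (hC : IsBasedClub C δ)
    (he : ∀ β < δ, ClosedAt (e β) β) : IsBasedClub (fill e C) δ := by
  refine ⟨?_, subset_fill hC.zero_mem, hC.clubAt.1.mono subset_fill, fun x hx hx0 hU ↦ ?_⟩
  · rintro x (hx | ⟨β, hβ, -, hlt, -⟩)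
    · exact hC.subset hx
    · exact hlt.trans (hC.subset hβ)
  · by_cases hxC : x ∈ C
    · exact Or.inl hxC
    obtain ⟨γ, hγ, β, hβ, hγx, hxβ, hgap⟩ := hC.exists_gap hx hxC
    refine Or.inr ⟨β, hβ, he β (hC.subset hβ) x hxβ hx0 fun y hy ↦ ?_, hxβ, γ, hγ, hγx, hgap⟩
    obtain ⟨a, ha, h1, h2⟩ := hU _ (max_lt hy hγx)
    have hγa : γ < a := (le_max_right _ _).trans_lt h1
    rcases ha with ha | ⟨β', hβ', haβ', hlt, γ', hγ', hγ'a, hgap'⟩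
    · exact ((hgap a ha).elim hγa.not_ge (h2.trans hxβ).not_ge).elim
    · have hβ'β : β' = β := by
        refine le_antisymm ?_ ?_
        · exact (hgap' β hβ).resolve_left (hγ'a.trans (h2.trans hxβ)).not_ge
        · exact (hgap β' hβ').resolve_left (hγa.trans hlt).not_ge
      exact ⟨a, hβ'β ▸ haβ', (le_max_left _ _).trans_lt h1, h2⟩

theorem sInf_Ici_eq_of_gap {C : Set Ordinal.{u}} {x β γ : Ordinal.{u}} (hβ : β ∈ C) (hγx : γ < x)
    (hxβ : x < β) (hgap : ∀ c ∈ C, c ≤ γ ∨ β ≤ c) : sInf (C ∩ Ici x) = β :=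
  le_antisymm (csInf_le' ⟨hβ, hxβ.le⟩) <| le_csInf ⟨β, hβ, hxβ.le⟩ fun c hc ↦
    (hgap c hc.1).resolve_left (hγx.trans_le hc.2).not_ge

/-- Let b be the next point of `C` at or after x. All x with the same b get ranks in the interval
(λ·r(b), λ·(r(b)+1)], ordered by the ladder rank, with b itself at the top. -/
theorem exists_rank_fill (h : IsLadder l L e ρ) (hl : ℵ₀ ≤ l) {C : Set Ordinal.{u}}
    (hCL : ∀ x ∈ C, x < L) {r : Ordinal.{u} → Ordinal.{u}} (hr : StrictMonoOn r C)
    {B : Ordinal.{u}} (hB : Order.IsSuccLimit B) (hrB : ∀ x ∈ C, r x < B) :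
    ∃ r' : Ordinal.{u} → Ordinal.{u}, StrictMonoOn r' (fill e C) ∧
      ∀ x ∈ fill e C, r' x < l.ord * B := by
  classical
  have hlim : Order.IsSuccLimit l.ord := isSuccLimit_ord hl
  let b : Ordinal.{u} → Ordinal.{u} := fun x ↦ sInf (C ∩ Ici x)
  let r' : Ordinal.{u} → Ordinal.{u} := fun x ↦
    if x ∈ C then l.ord * Order.succ (r x) else l.ord * r (b x) + Order.succ (ρ (b x) x)
  have hb : ∀ x ∈ fill e C, b x ∈ C ∧ x ≤ b x ∧ (x ∈ C → b x = x) ∧ (x ∉ C → x ∈ e (b x)) := by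
    rintro x (hx | ⟨β, hβ, hxβ, hlt, γ, -, hγx, hgap⟩)
    · have : b x = x := le_antisymm (csInf_le' ⟨hx, mem_Ici.2 le_rfl⟩) (le_csInf ⟨x, hx, mem_Ici.2 le_rfl⟩ fun c hc ↦ hc.2)
      rw [this]
      exact ⟨hx, le_rfl, fun _ ↦ rfl, fun h ↦ (h hx).elim⟩
    · have hbx : b x = β := sInf_Ici_eq_of_gap hβ hγx hlt hgap
      rw [hbx]
      refine ⟨hβ, hlt.le, fun hx ↦ ?_, fun _ ↦ hxβ⟩
      exact ((hgap x hx).elim hγx.not_ge hlt.not_ge).elim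
  have hup : ∀ x ∈ fill e C, r' x ≤ l.ord * Order.succ (r (b x)) := fun x hx ↦ by
    obtain ⟨h1, h2, h3, h4⟩ := hb x hx
    by_cases hxC : x ∈ C
    · simp only [r', if_pos hxC, h3 hxC, le_refl]
    · simp only [r', if_neg hxC, Ordinal.mul_succ]
      exact add_le_add_right (hlim.succ_lt (h.rank_lt _ (hCL _ h1) _ (h4 hxC))).le _
  have hdown : ∀ x ∈ fill e C, l.ord * r (b x) < r' x := fun x hx ↦ by
    obtain ⟨h1, h2, h3, h4⟩ := hb x hx
    by_cases hxC : x ∈ C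
    · simp only [r', if_pos hxC, h3 hxC, Ordinal.mul_succ]
      exact lt_add_of_pos_right _ hlim.bot_lt
    · simp only [r', if_neg hxC]
      exact lt_add_of_pos_right _ (Order.bot_lt_succ _)
  refine ⟨r', fun x hx x' hx' hxx' ↦ ?_, fun x hx ↦ ?_⟩
  · obtain ⟨h1, h2, h3, h4⟩ := hb x hx
    obtain ⟨h1', h2', h3', h4'⟩ := hb x' hx'
    have hbb : b x ≤ b x' := csInf_le' ⟨h1', hxx'.le.trans h2'⟩
    rcases hbb.lt_or_eq with hlt | heq
    · refine (hup x hx).trans_lt ((mul_le_mul_right ?_ _).trans_lt (hdown x' hx'))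
      exact Order.succ_le_of_lt (hr h1 h1' hlt)
    · have hxC : x ∉ C := fun hxC ↦ by
        rw [← heq, h3 hxC] at h2'
        exact h2'.not_gt hxx'
      have hlt := h.rank_lt _ (hCL _ h1) _ (h4 hxC)
      by_cases hxC' : x' ∈ C
      · simp only [r', if_neg hxC, if_pos hxC', Ordinal.mul_succ, heq, h3' hxC']
        rw [heq, h3' hxC'] at hlt
        exact add_lt_add_right (hlim.succ_lt hlt) _
      · simp only [r', if_neg hxC, if_neg hxC', heq]
        refine add_lt_add_right (Order.succ_lt_succ ?_) _
        exact h.strictMonoOn _ (hCL _ h1') (heq ▸ h4 hxC) (h4' hxC') hxx'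
  · obtain ⟨h1, -⟩ := hb x hx
    refine (hup x hx).trans_lt ?_
    exact (mul_lt_mul_iff_right₀ hlim.bot_lt).2 (hB.succ_lt (hrB _ h1))

end

/-! ### The levels: locality, order type, exhaustion -/

section

variable {l : Cardinal.{u}} {L : Ordinal.{u}} {e : Ordinal.{u} → Set Ordinal.{u}}
  {ρ : Ordinal.{u} → Ordinal.{u} → Ordinal.{u}} {g : Ordinal.{u} → Ordinal.{u} → Ordinal.{u}}

/-- The closure of `A` in `δ`, together with `0`. -/
def closureIn (A : Set Ordinal.{u}) (δ : Ordinal.{u}) : Set Ordinal.{u} :=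
  {x | x < δ ∧ (x ∈ A ∨ UnbddAt A x)}

theorem UnbddAt.of_closureIn {A : Set Ordinal.{u}} {δ x : Ordinal.{u}}
    (h : UnbddAt (closureIn A δ) x) : UnbddAt A x := fun y hy ↦ by
  obtain ⟨a, ha, h1, h2⟩ := h y hy
  rcases ha.2 with ha' | ha'
  · exact ⟨a, ha', h1, h2⟩
  · obtain ⟨b, hb, h3, h4⟩ := ha' y h1
    exact ⟨b, hb, h3, h4.trans h2⟩

theorem unbddAt_zero (A : Set Ordinal.{u}) : UnbddAt A 0 := fun _ h ↦ (not_lt_zero h).elim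

theorem isBasedClub_closureIn {A : Set Ordinal.{u}} {δ : Ordinal.{u}} (hδ : δ ≠ 0)
    (hA : UnbddAt A δ) : IsBasedClub (closureIn A δ) δ := by
  refine ⟨fun x hx ↦ hx.1, ⟨pos_iff_ne_zero.2 hδ, Or.inr (unbddAt_zero A)⟩, fun y hy ↦ ?_,
    fun x hx _ h ↦ ⟨hx, Or.inr h.of_closureIn⟩⟩
  obtain ⟨a, ha, h1, h2⟩ := hA y hy
  exact ⟨a, ⟨h2, Or.inl ha⟩, h1, h2⟩

theorem closureIn_inter_Iio {A : Set Ordinal.{u}} {δ ε : Ordinal.{u}} (hε : ε ≤ δ) :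
    closureIn (A ∩ Iio ε) ε = closureIn A δ ∩ Iio ε := by
  ext x
  have hx : x < ε → (UnbddAt (A ∩ Iio ε) x ↔ UnbddAt A x) := fun hxε ↦
    ⟨fun h ↦ h.mono inter_subset_left, fun h y hy ↦
      let ⟨a, ha, h1, h2⟩ := h y hy; ⟨a, ⟨ha, h2.trans hxε⟩, h1, h2⟩⟩
  constructor
  · rintro ⟨h1, h2 | h2⟩
    · exact ⟨⟨h1.trans_le hε, Or.inl h2.1⟩, h1⟩
    · exact ⟨⟨h1.trans_le hε, Or.inr ((hx h1).1 h2)⟩, h1⟩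
  · rintro ⟨⟨-, h2 | h2⟩, h1⟩
    · exact ⟨h1, Or.inl ⟨h2, h1⟩⟩
    · exact ⟨h1, Or.inr ((hx h1).2 h2)⟩

theorem exists_strictMonoOn_of_mk_lt {C : Set Ordinal.{u}}
    (hC : #C < Cardinal.lift.{u + 1} l) :
    ∃ r : Ordinal.{u} → Ordinal.{u}, StrictMonoOn r C ∧ ∀ x ∈ C, r x < l.ord := by
  classical
  have htype : typeLT C < Ordinal.lift.{u + 1} l.ord := by
    rw [lift_ord, lt_ord, card_type]
    exact hC
  have h : ∀ x : C, ∃ r : Ordinal.{u}, Ordinal.lift.{u + 1} r = typein (α := C) (· < ·) x ∧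
      r < l.ord := fun x ↦ by
    have hx : typein (α := C) (· < ·) x < Ordinal.lift.{u + 1} l.ord :=
      (typein_lt_type _ x).trans htype
    obtain ⟨r, hr⟩ := Ordinal.mem_range_lift_of_le hx.le
    exact ⟨r, hr, by rwa [← hr, Ordinal.lift_lt] at hx⟩
  choose r hr hrl using h
  refine ⟨fun x ↦ if hx : x ∈ C then r ⟨x, hx⟩ else 0, fun x hx y hy hxy ↦ ?_, fun x hx ↦ ?_⟩
  · simp only [dif_pos hx, dif_pos hy]
    rw [← Ordinal.lift_lt.{u + 1}, hr, hr, typein_lt_typein]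
    exact hxy
  · simp only [dif_pos hx]
    exact hrl _

theorem mk_closureIn_lt (hl : ℵ₀ ≤ l) {A : Set Ordinal.{u}} {δ : Ordinal.{u}} (hA : UnbddAt A δ)
    (hcard : #A < Cardinal.lift.{u + 1} l) : #(closureIn A δ) < Cardinal.lift.{u + 1} l := by
  have h : closureIn A δ ⊆ A ∪ (fun b ↦ sSup (A ∩ Iio b)) '' A := by
    rintro x ⟨hxδ, hx | hx⟩
    · exact Or.inl hx
    · obtain ⟨a, ha, h1, -⟩ := hA x hxδ
      obtain ⟨b, hb, hbx⟩ := hx.exists_sSup_inter_eq ⟨a, ha, h1.le⟩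
      exact Or.inr ⟨b, hb, hbx⟩
  refine (mk_le_mk_of_subset h).trans_lt ((mk_union_le _ _).trans_lt ?_)
  exact add_lt_of_lt (by simpa using hl) hcard (mk_image_le.trans_lt hcard)

/-- The `n`-fold filling of the closure of stage `ν` of the listing of `δ`. -/
def level (g : Ordinal.{u} → Ordinal.{u} → Ordinal.{u}) (e : Ordinal.{u} → Set Ordinal.{u})
    (δ ν : Ordinal.{u}) (n : ℕ) : Set Ordinal.{u} :=
  (fill e)^[n] (closureIn (listed g δ ν) δ)

theorem level_zero {δ ν : Ordinal.{u}} : level g e δ ν 0 = closureIn (listed g δ ν) δ := rfl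

theorem level_succ {δ ν : Ordinal.{u}} {n : ℕ} :
    level g e δ ν (n + 1) = fill e (level g e δ ν n) :=
  Function.iterate_succ_apply' _ _ _

theorem isBasedClub_level (he : IsLadder l L e ρ) {δ ν : Ordinal.{u}} (hδ : δ ≠ 0) (hδL : δ < L)
    (h : UnbddAt (listed g δ ν) δ) (n : ℕ) : IsBasedClub (level g e δ ν n) δ := by
  induction n with
  | zero => exact isBasedClub_closureIn hδ h
  | succ n ih =>
    rw [level_succ]
    exact ih.fill fun β hβ ↦ he.closedAt β (hβ.trans hδL)

theorem exists_rank_level (he : IsLadder l L e ρ) (hl : ℵ₀ ≤ l) {δ ν : Ordinal.{u}} (hδ : δ ≠ 0)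
    (hδL : δ < L) (hν : ν < l.ord) (h : UnbddAt (listed g δ ν) δ) (n : ℕ) :
    ∃ r : Ordinal.{u} → Ordinal.{u}, StrictMonoOn r (level g e δ ν n) ∧
      ∀ x ∈ level g e δ ν n, r x < l.ord ^ (n + 1) := by
  induction n with
  | zero =>
    simpa [level_zero] using exists_strictMonoOn_of_mk_lt (mk_closureIn_lt hl h (mk_listed_lt hν))
  | succ n ih =>
    obtain ⟨r, hr, hrl⟩ := ih
    rw [level_succ, pow_succ' _ (n + 1)]
    refine exists_rank_fill he hl (fun x hx ↦ ?_) hr ?_ hrl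
    · exact ((isBasedClub_level he hδ hδL h n).subset hx).out.trans hδL
    · rw [pow_succ]
      exact isSuccLimit_mul_right (pow_pos (isSuccLimit_ord hl).bot_lt n) (isSuccLimit_ord hl)

theorem subset_level (n : ℕ) {δ ν : Ordinal.{u}} : listed g δ ν ⊆ level g e δ ν n := by
  induction n with
  | zero => exact fun x hx ↦ ⟨hx.1, Or.inl hx⟩
  | succ n ih => rw [level_succ]; exact ih.trans subset_fill

theorem level_eq_inter {δ ν ε : Ordinal.{u}} (h : listed g ε ν = listed g δ ν ∩ Iio ε) (hε : ε ≤ δ)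
    (hU : UnbddAt (listed g δ ν) ε) (n : ℕ) : level g e ε ν n = level g e δ ν n ∩ Iio ε := by
  induction n with
  | zero => rw [level_zero, level_zero, h, closureIn_inter_Iio hε]
  | succ n ih => rw [level_succ, level_succ, ih, fill_inter_Iio (hU.mono (subset_level n))]

/-- While x is missed, filling inserts a ladder point of `e β` at or above x and below the next
point β. The next points would thus decrease forever. -/
theorem exists_mem_level (he : IsLadder l L e ρ) {δ ν : Ordinal.{u}} (hδL : δ < L)
    (h : UnbddAt (listed g δ ν) δ) {x : Ordinal.{u}} (hx : x < δ) : ∃ n, x ∈ level g e δ ν n := by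
  by_contra! hcon
  have hδ : δ ≠ 0 := fun h ↦ not_lt_zero (h ▸ hx)
  refine not_strictAnti_of_wellFoundedLT (fun n ↦ sInf (level g e δ ν n ∩ Ici x))
    (strictAnti_nat_of_succ_lt fun n ↦ ?_)
  have hC := isBasedClub_level he hδ hδL h n
  obtain ⟨γ, hγ, β, hβ, hγx, hxβ, hgap⟩ := hC.exists_gap hx (hcon n)
  rw [sInf_Ici_eq_of_gap hβ hγx hxβ hgap]
  obtain ⟨y, hy, hxy, hyβ⟩ := he.cofinal β (((hC.subset hβ).out).trans hδL) x hxβ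
  have hy' : y ∈ level g e δ ν (n + 1) ∩ Ici x := ⟨?_, hxy⟩
  · exact (csInf_le' hy').trans_lt hyβ
  rw [level_succ]
  exact Or.inr ⟨β, hβ, hy, hyβ, γ, hγ, hγx.trans_le hxy, hgap⟩

/-- Take the first level containing x. At level 0 the underlying stage has fewer than λ elements and
cannot accumulate at x. At a later level x enters inside a gap, where the level is a piece of a
ladder `e β` with x < β, and ladders do not accumulate at such points of cofinality λ. -/
theorem exists_mem_level_not_unbddAt (he : IsLadder l L e ρ) {δ ν : Ordinal.{u}}
    (hδL : δ < L) (hν : ν < l.ord) (h : UnbddAt (listed g δ ν) δ) {x : Ordinal.{u}} (hx : x < δ)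
    (hxl : x.cof = l) : ∃ n, x ∈ level g e δ ν n ∧ ¬ UnbddAt (level g e δ ν n) x := by
  classical
  have hex := exists_mem_level he hδL h hx
  have hδ : δ ≠ 0 := fun h ↦ not_lt_zero (h ▸ hx)
  refine ⟨Nat.find hex, Nat.find_spec hex, ?_⟩
  rcases hn : Nat.find hex with _ | n
  · intro hU
    refine not_unbddAt_of_mk_lt ?_ hU.of_closureIn
    rw [hxl]
    exact (mk_le_mk_of_subset inter_subset_left).trans_lt (mk_listed_lt hν)
  · have hmem := Nat.find_spec hex
    have hnot := Nat.find_min hex (m := n) (by omega)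
    rw [hn, level_succ] at hmem
    have hC := isBasedClub_level he hδ hδL h n
    rw [level_succ]
    rcases hmem with hmem | ⟨β, hβ, hxβ, hlt, γ, hγ, hγx, hgap⟩
    · exact (hnot hmem).elim
    · intro hU
      refine he.not_unbddAt hlt ((hC.subset hβ).out.trans hδL) hxl fun y hy ↦ ?_
      obtain ⟨a, ha, h1, h2⟩ := hU _ (max_lt hy hγx)
      have hγa : γ < a := (le_max_right _ _).trans_lt h1
      rcases ha with ha | ⟨β', hβ', haβ', hlt', γ', hγ', hγ'a, hgap'⟩
      · exact ((hgap a ha).elim hγa.not_ge (h2.trans hlt).not_ge).elim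
      · have hβ'β : β' = β := le_antisymm
          ((hgap' β hβ).resolve_left (hγ'a.trans (h2.trans hlt)).not_ge)
          ((hgap β' hβ').resolve_left (hγa.trans hlt').not_ge)
        exact ⟨a, hβ'β ▸ haβ', (le_max_left _ _).trans_lt h1, h2⟩

theorem mem_nacc_of_not_unbddAt {C : Set Ordinal.{u}} {x : Ordinal.{u}} (hx : x ∈ C)
    (h : ¬ UnbddAt C x) : x ∈ nacc C := by
  refine ⟨hx, fun hacc ↦ h fun y hy ↦ ?_⟩
  rw [hacc.2] at hy
  obtain ⟨a, ha, h1⟩ := exists_lt_of_lt_csSup' hy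
  exact ⟨a, ha.1, h1, ha.2⟩

/-- An unbounded set of points of cofinality `l` is guessed at some level. -/
theorem exists_level_unbddAt (he : IsLadder l L e ρ) {δ ν : Ordinal.{u}}
    (hδ : ℵ₀ < δ.cof) (hδL : δ < L) (hν : ν < l.ord) (h : UnbddAt (listed g δ ν) δ)
    {A : Set Ordinal.{u}} (hA : ∀ x ∈ A, x.cof = l) (hAδ : UnbddAt A δ) :
    ∃ n, UnbddAt {x | x ∈ A ∧ x ∈ level g e δ ν n ∧ ¬ UnbddAt (level g e δ ν n) x} δ := by
  by_contra! hcon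
  have hcon' : ∀ n, ∃ y < δ, ∀ x, x ∈ A → x ∈ level g e δ ν n →
      ¬ UnbddAt (level g e δ ν n) x → y < x → ¬ x < δ := fun n ↦ by
    have := hcon n
    simp only [UnbddAt, not_forall] at this
    obtain ⟨y, hy, hy'⟩ := this
    exact ⟨y, hy, fun x h1 h2 h3 h4 h5 ↦ hy' ⟨x, ⟨h1, h2, by simpa [UnbddAt] using h3⟩, h4, h5⟩⟩
  choose y hy hy' using hcon'
  obtain ⟨z, hz, hz'⟩ := exists_bound_nat y hδ hy
  obtain ⟨a, ha, h1, h2⟩ := hAδ z hz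
  obtain ⟨n, hn, hn'⟩ := exists_mem_level_not_unbddAt he hδL hν h h2 (hA a ha)
  exact hy' n a ha hn hn' ((hz' n).trans_lt h1) h2

end

/-! ### Guessing clubs from a colouring -/

section

variable {l : Cardinal.{u}} {L : Ordinal.{u}} {e : Ordinal.{u} → Set Ordinal.{u}}
  {ρ : Ordinal.{u} → Ordinal.{u} → Ordinal.{u}} {g : Ordinal.{u} → Ordinal.{u} → Ordinal.{u}}

theorem otpLE_of_strictMonoOn {C : Set Ordinal.{u}} {γ : Ordinal.{u}}
    {r : Ordinal.{u} → Ordinal.{u}} (hr : StrictMonoOn r C) (hrγ : ∀ x ∈ C, r x < γ) :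
    OtpLE C γ := by
  rw [OtpLE, ← type_lt_Iio]
  refine (RelEmbedding.ofMonotone (fun x : C ↦ (⟨r x, hrγ x x.2⟩ : Iio γ)) ?_).ordinal_type_le
  exact fun x y hxy ↦ hr x.2 y.2 hxy

theorem IsBasedClub.isClubIn {C : Set Ordinal.{u}} {δ : Ordinal.{u}} (h : IsBasedClub C δ) :
    IsClubIn C δ :=
  ⟨h.subset, isClub_of_clubAt h.clubAt⟩

theorem isUnboundedIn_cofSet (hl : l.IsRegular) :
    IsUnboundedIn (cofSet (Order.succ l).ord l) (Order.succ l).ord := by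
  refine ⟨fun x hx ↦ hx.1, fun α hα ↦ ⟨α + l.ord, ⟨?_, ?_⟩, ?_⟩⟩
  · rw [lt_ord, Order.lt_succ_iff, card_add, card_ord]
    exact add_le_of_le hl.1 (Order.lt_succ_iff.1 (lt_ord.1 hα)) le_rfl
  · rw [cof_add _ hl.ord_pos.ne', hl.cof_ord]
  · exact lt_add_of_pos_right _ hl.ord_pos

theorem mk_setOf_max_lt (hl : ℵ₀ ≤ l) {x : Ordinal.{u}} (hx : x < (Order.succ l).ord) :
    #{p : Ordinal.{u} × Ordinal.{u} × Ordinal.{u} × Ordinal.{u} |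
      max p.1 (max p.2.1 (max p.2.2.1 p.2.2.2)) < x} < Cardinal.lift.{u + 1} (Order.succ l) := by
  have hsub : {p : Ordinal.{u} × Ordinal.{u} × Ordinal.{u} × Ordinal.{u} |
      max p.1 (max p.2.1 (max p.2.2.1 p.2.2.2)) < x} ⊆ Iio x ×ˢ (Iio x ×ˢ (Iio x ×ˢ Iio x)) := by
    rintro ⟨a, b, c, d⟩ h
    simpa [max_lt_iff] using h
  refine (mk_le_mk_of_subset hsub).trans_lt ?_
  have hI : #(Iio x) ≤ Cardinal.lift.{u + 1} l := by
    rw [Cardinal.mk_Iio_ordinal, Cardinal.lift_le]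
    exact Order.lt_succ_iff.1 (lt_ord.1 hx)
  have hL : ℵ₀ ≤ Cardinal.lift.{u + 1} l := by simpa using hl
  rw [mk_setProd, mk_setProd, mk_setProd]
  refine (mul_le_of_le hL hI (mul_le_of_le hL hI (mul_le_of_le hL hI hI))).trans_lt ?_
  exact Cardinal.lift_lt.2 (Order.lt_succ l)

/-- If finitely many parameters below `δ` suffice to colour `S ∩ δ` with natural numbers so that
every colour is stationary in `δ`, then guessing clubs exist. -/
theorem hasGuessingClubs_of_coloring (hl : l.IsRegular) {κ θ : Cardinal.{u}} (hκ : ℵ₀ < κ)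
    (hκl : κ < l) (hθ : ℵ₀ < θ) {S : Set Ordinal.{u}} (hS : S ⊆ cofSet (Order.succ l).ord θ)
    (hS₁ : StatAt (reflectionSet S (Order.succ l).ord κ) (Order.succ l).ord)
    (hg : ∀ ε < (Order.succ l).ord, ∀ β < ε, ∃ i < l.ord, g ε i = β)
    (H : Ordinal.{u} → Ordinal.{u} → Ordinal.{u} → Ordinal.{u} → Ordinal.{u} → ℕ)
    (hH : ∀ δ < (Order.succ l).ord, l.ord < δ → δ.cof = κ → StatAt S δ →
      ∀ ν < l.ord, CoherentAt g δ ν →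
        ∃ a < δ, ∃ b < δ, ∃ c < δ, ∀ n, StatAt {ε | ε ∈ S ∧ H ν a b c ε = n} δ)
    {γ : Ordinal.{u}} (hγ : l.ord ^ (ω : Ordinal.{u}) ≤ γ) : HasGuessingClubs l S γ := by
  by_contra hno
  set L := (Order.succ l).ord with hLdef
  have hreg : (Order.succ l).IsRegular := isRegular_succ hl.1
  have hLcof : L.cof = Order.succ l := hreg.cof_ord
  have hLω : ℵ₀ < L.cof := hLcof ▸ Order.lt_succ_of_le hl.1
  have hLlim := isSuccLimit_of_aleph0_lt_cof hLω
  obtain ⟨e, ρ, he⟩ := exists_isLadder hl.1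
  have hfail : ∀ p : {p : Ordinal.{u} × Ordinal.{u} × Ordinal.{u} × Ordinal.{u} // p.1 < l.ord},
      ∃ A D : Set Ordinal.{u}, A ⊆ cofSet L l ∧ UnbddAt A L ∧ ClubAt D L ∧
        ∀ ε < L, ε ∈ S → UnbddAt (listed g ε p.1.1) ε → ε ∈ D →
          ε ≠ sSup (A ∩ nacc (level g e ε p.1.1 (H p.1.1 p.1.2.1 p.1.2.2.1 p.1.2.2.2 ε))) := by
    rintro ⟨⟨ν, a, b, c⟩, hν⟩
    -- If no pair (A, D) defeats these parameters, the clubs they define guess every A, against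
    -- `hno`.
    by_contra! hcon
    have hguess : ∀ A : Set Ordinal.{u}, A ⊆ cofSet L l → IsUnboundedIn A L →
        StatAt {ε | ε ∈ {ε | ε ∈ S ∧ UnbddAt (listed g ε ν) ε} ∧
          ε = sSup (A ∩ nacc (level g e ε ν (H ν a b c ε)))} L := by
      intro A hA hAu D hD
      obtain ⟨ε, h1, h2, h3, h4, h5⟩ := hcon A D hA (fun y hy ↦
        let ⟨x, hx, hyx⟩ := hAu.2 y hy; ⟨x, hx, hyx, hAu.1 hx⟩) hD
      exact ⟨ε, ⟨⟨h2, h3⟩, h5⟩, h1, h4⟩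
    refine hno ⟨{ε | ε ∈ S ∧ UnbddAt (listed g ε ν) ε}, fun ε hε ↦ hε.1, ?_,
      fun ε ↦ level g e ε ν (H ν a b c ε), fun ε hε ↦ ?_, fun A hA hAu ↦ ?_⟩
    -- Stationarity of S' comes from guessing the whole set of points of cofinality λ.
    · rw [isStationaryIn_iff hLlim]
      exact (hguess _ Subset.rfl (isUnboundedIn_cofSet hl)).mono fun ε hε ↦ hε.1
    · have hεL := (hS hε.1).1
      have hε0 : ε ≠ 0 := by
        rintro rfl
        have := (hS hε.1).2
        rw [cof_zero] at this
        exact not_lt_zero (this ▸ hθ)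
      obtain ⟨r, hr, hrl⟩ := exists_rank_level he hl.1 hε0 hεL hν hε.2 (H ν a b c ε)
      refine ⟨(isBasedClub_level he hε0 hεL hε.2 _).isClubIn,
        otpLE_of_strictMonoOn hr fun x hx ↦ (hrl x hx).trans_le (le_trans ?_ hγ)⟩
      rw [← opow_natCast]
      exact opow_le_opow_right hl.ord_pos (natCast_lt_omega0 _).le
    · rw [isStationaryIn_iff hLlim]
      exact hguess A hA hAu
  choose A D hA hAu hD hAD using hfail
  -- At most λ parameter tuples lie below any x < λ⁺, so the counterexamples can be diagonalised.
  have hdiag := clubAt_diagonal hLω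
    (fun p : {p : Ordinal.{u} × Ordinal.{u} × Ordinal.{u} × Ordinal.{u} // p.1 < l.ord} ↦
      max p.1.1 (max p.1.2.1 (max p.1.2.2.1 p.1.2.2.2)))
    (fun p ↦ {x | 0 < x ∧ x ∈ {x | UnbddAt (A p) x} ∧ x ∈ {x | UnbddAt (D p) x}})
    (fun x hx ↦ by
      rw [hLcof]
      refine lt_of_le_of_lt ?_ (mk_setOf_max_lt hl.1 hx)
      exact mk_le_of_injective (f := fun i ↦ ⟨i.1.1, i.2⟩)
        fun i j hij ↦ Subtype.ext (Subtype.ext (congrArg Subtype.val hij :)))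
    (fun p ↦ (clubAt_setOf_unbddAt hLω (hAu p)).inter hLω (clubAt_setOf_unbddAt hLω (hD p).1))
  have hlL : l.ord < L := ord_lt_ord.2 (Order.lt_succ l)
  obtain ⟨δ, ⟨hδL, hδκ, hδS⟩, -, -, hlδ, hδd⟩ := hS₁ _ ((clubAt_Ioi hLlim hlL).inter hLω hdiag)
  have hδω : ℵ₀ < δ.cof := hδκ ▸ hκ
  have hδlim := isSuccLimit_of_aleph0_lt_cof hδω
  rw [isStationaryIn_iff hδlim] at hδS
  obtain ⟨ν, hν, hcoh⟩ := exists_coherentAt hl (fun ε hε ↦ hg ε (hε.trans_lt hδL)) hδω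
    (hδκ ▸ hκl)
  obtain ⟨a, ha, b, hb, c, hc, hst⟩ := hH δ hδL hlδ hδκ hδS ν hν hcoh
  set p : {p : Ordinal.{u} × Ordinal.{u} × Ordinal.{u} × Ordinal.{u} // p.1 < l.ord} :=
    ⟨(ν, a, b, c), hν⟩ with hp
  obtain ⟨-, hAδ, hDδ⟩ := hδd p (max_lt (hν.trans hlδ) (max_lt ha (max_lt hb hc)))
  obtain ⟨n, hn⟩ := exists_level_unbddAt he hδω hδL hν hcoh.unbddAt (fun x hx ↦ (hA p hx).2) hAδ
  -- ε has colour n, lies in the bad club, and is a limit both of the points captured at level n and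
  -- of the coherent stage.
  obtain ⟨ε, ⟨hεS, hεn⟩, hεδ, -, hεD, -, hεW, hεl⟩ := hst n _
    (ClubAt.inter hδω (C := D p) ⟨hDδ, fun x hx ↦ (hD p).2 x (hx.trans hδL)⟩
      ((clubAt_setOf_unbddAt hδω hn).inter hδω (clubAt_setOf_unbddAt hδω hcoh.unbddAt)))
  have hεmem := hcoh.mem_of_unbddAt ε hεδ ((hS hεS).2 ▸ hθ) hεl
  have heq := hcoh.eq_inter ε hεmem
  have hlev := level_eq_inter (e := e) heq hεδ.le hεl n
  refine hAD p ε (hεδ.trans hδL) hεS ?_ hεD ?_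
  · rw [heq]
    intro y hy
    obtain ⟨x, hx, h1, h2⟩ := hεl y hy
    exact ⟨x, ⟨hx, h2⟩, h1, h2⟩
  · simp only [hp, hεn]
    refine le_antisymm (le_of_forall_lt fun y hy ↦ ?_) (csSup_le' fun x hx ↦ ?_)
    · obtain ⟨x, ⟨hxA, hxl, hxn⟩, h1, h2⟩ := hεW y hy
      refine h1.trans_le (le_csSup ⟨ε, fun z hz ↦ ?_⟩ ⟨hxA, mem_nacc_of_not_unbddAt ?_ ?_⟩)
      · have := hz.2.1
        rw [hlev] at this
        exact this.2.out.le
      · rw [hlev]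
        exact ⟨hxl, h2⟩
      · rw [hlev]
        exact fun h ↦ hxn (h.mono inter_subset_left)
    · have := hx.2.1
      rw [hlev] at this
      exact this.2.out.le

end

/-! ### Splitting stationary sets; the colouring above the continuum -/

section

variable {l : Cardinal.{u}} {g : Ordinal.{u} → Ordinal.{u} → Ordinal.{u}}

/-- Each `c ε`, for `ε` of cofinality `θ`, is a cofinal map from `θ` to `ε`. -/
def IsCofinalSystem (c : Ordinal.{u} → Ordinal.{u} → Ordinal.{u}) (θ : Cardinal.{u}) : Prop :=
  ∀ ε, ε.cof = θ → (∀ i < θ.ord, c ε i < ε) ∧ ∀ y < ε, ∃ i < θ.ord, y < c ε i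

theorem exists_cofinal_fun {δ : Ordinal.{u}} (hδ : Order.IsSuccLimit δ) :
    ∃ f : Ordinal.{u} → Ordinal.{u}, StrictMonoOn f (Iio δ.cof.ord) ∧
      (∀ i < δ.cof.ord, f i < δ) ∧ ∀ y < δ, ∃ i < δ.cof.ord, y < f i := by
  classical
  obtain ⟨f, hf⟩ := exists_isFundamentalSeq (o := δ) rfl
  refine ⟨fun i ↦ if h : i < δ.cof.ord then f ⟨i, h⟩ else 0, fun i hi j hj hij ↦ ?_,
    fun i hi ↦ ?_, fun y hy ↦ ?_⟩
  · simp only [dif_pos hi.out, dif_pos hj.out]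
    exact hf.strictMono hij
  · simp only [dif_pos hi]
    exact (f _).2
  · obtain ⟨_, ⟨i, rfl⟩, hi⟩ := hf.isCofinal_range ⟨Order.succ y, hδ.succ_lt hy⟩
    refine ⟨i, i.2, ?_⟩
    simp only [dif_pos i.2.out]
    exact (Order.lt_succ y).trans_le hi

theorem exists_isCofinalSystem {θ : Cardinal.{u}} (hθ : ℵ₀ ≤ θ) :
    ∃ c : Ordinal.{u} → Ordinal.{u} → Ordinal.{u}, IsCofinalSystem c θ := by
  have h : ∀ ε : Ordinal.{u}, ∃ f : Ordinal.{u} → Ordinal.{u}, ε.cof = θ →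
      (∀ i < θ.ord, f i < ε) ∧ ∀ y < ε, ∃ i < θ.ord, y < f i := by
    intro ε
    by_cases hε : ε.cof = θ
    · obtain ⟨f, -, h1, h2⟩ := exists_cofinal_fun
        (one_lt_cof_iff.1 (hε ▸ one_lt_aleph0.trans_le hθ))
      exact ⟨f, fun _ ↦ hε ▸ ⟨h1, h2⟩⟩
    · exact ⟨id, fun h ↦ (hε h).elim⟩
  choose c hc using h
  exact ⟨c, hc⟩

section Splitting

variable {c : Ordinal.{u} → Ordinal.{u} → Ordinal.{u}} {θ : Cardinal.{u}} {δ : Ordinal.{u}}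
  {X : Set Ordinal.{u}}

/-- Otherwise each i < θ has a bound η_i and a club refuting it. As θ < cf(δ), the η_i have a common
bound y < δ; for ε > y in all the clubs, cofinality of `c ε` yields a coordinate above y. -/
theorem exists_index_statAt (hc : IsCofinalSystem c θ) (hδ : ℵ₀ < δ.cof) (hθδ : θ < δ.cof)
    (hX : ∀ ε ∈ X, ε.cof = θ) (hst : StatAt X δ) :
    ∃ i < θ.ord, ∀ η < δ, StatAt {ε | ε ∈ X ∧ η ≤ c ε i} δ := by
  by_contra! hcon
  simp only [not_statAt_iff] at hcon
  choose! η hη D hD hDη using hcon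
  obtain ⟨y, hy, hy'⟩ := exists_bound_Iio η (o := θ.ord) (by rwa [card_ord]) hη
  have hdiag := clubAt_diagonal hδ (ι := Iio θ.ord) (fun _ ↦ 0) (fun i ↦ D i)
    (fun x _ ↦ (mk_set_le _).trans_lt (by
      rwa [Cardinal.mk_Iio_ordinal, card_ord, Cardinal.lift_lt])) (fun i ↦ hD i i.2)
  obtain ⟨ε, hεX, hεδ, hε0, hεy, hεD⟩ := hst _
    ((clubAt_Ioi (isSuccLimit_of_aleph0_lt_cof hδ) hy).inter hδ hdiag)
  obtain ⟨i, hi, hyi⟩ := (hc ε (hX ε hεX)).2 y hεy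
  exact hDη i hi ε ⟨hεX, (hy' i hi).trans hyi.le⟩ hεδ (hεD ⟨i, hi⟩ hε0)

/-- A pressing-down argument: ε ↦ `c ε i` is regressive, so its values are bounded on a stationary
subset. The diagonal intersection runs along a cofinal sequence of length cf(δ). -/
theorem exists_statAt_Ico (hc : IsCofinalSystem c θ) (hδ : ℵ₀ < δ.cof)
    (hX : ∀ ε ∈ X, ε.cof = θ) {i : Ordinal.{u}} (hi : i < θ.ord) {η : Ordinal.{u}}
    (hst : StatAt {ε | ε ∈ X ∧ η ≤ c ε i} δ) :
    ∃ η' < δ, StatAt {ε | ε ∈ X ∧ η ≤ c ε i ∧ c ε i < η'} δ := by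
  by_contra! hcon
  simp only [not_statAt_iff] at hcon
  choose! D hD hDη using hcon
  obtain ⟨f, hf, hfδ, hfu⟩ := exists_cofinal_fun (isSuccLimit_of_aleph0_lt_cof hδ)
  have hdiag := clubAt_diagonal hδ (ι := Iio δ.cof.ord) (fun j ↦ f j) (fun j ↦ D (f j))
    (fun x hx ↦ by
      obtain ⟨j, hj, hxj⟩ := hfu x hx
      have hinj : Function.Injective (fun k : {k : Iio δ.cof.ord | f k < x} ↦
          (⟨k.1.1, (hf.lt_iff_lt k.1.2 hj).1 (k.2.out.trans hxj)⟩ : Iio j)) := fun a b hab ↦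
        Subtype.ext (Subtype.ext (congrArg Subtype.val hab :))
      refine (mk_le_of_injective hinj).trans_lt ?_
      rw [Cardinal.mk_Iio_ordinal, Cardinal.lift_lt]
      exact lt_ord.1 hj) (fun j ↦ hD _ (hfδ j j.2))
  have hU : UnbddAt (f '' Iio δ.cof.ord) δ := fun y hy ↦
    let ⟨j, hj, hyj⟩ := hfu y hy; ⟨f j, ⟨j, hj, rfl⟩, hyj, hfδ j hj⟩
  obtain ⟨ε, ⟨hεX, hε⟩, hεδ, hε0, hεU, hεD⟩ := hst _ ((clubAt_setOf_unbddAt hδ hU).inter hδ hdiag)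
  obtain ⟨_, ⟨j, hj, rfl⟩, h1, h2⟩ := hεU _ ((hc ε (hX ε hεX)).1 i hi)
  exact hDη _ (hfδ j hj) ε ⟨hεX, hε, h1⟩ hεδ (hεD ⟨j, hj⟩ h2)

/-- A stationary set of points of small cofinality splits into infinitely many stationary sets
according to the blocks of an `ω`-sequence. -/
theorem exists_splitting (hc : IsCofinalSystem c θ) (hδ : ℵ₀ < δ.cof) (hθδ : θ < δ.cof)
    (hX : ∀ ε ∈ X, ε.cof = θ) (hst : StatAt X δ) :
    ∃ i < θ.ord, ∃ s : ℕ → Ordinal.{u}, StrictMono s ∧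
      (∀ n, StatAt {ε | ε ∈ X ∧ s n ≤ c ε i ∧ c ε i < s (n + 1)} δ) ∧
      ∃ y < δ, (∀ n, s n < y) ∧ ∀ z < y, ∃ n, z < s n := by
  obtain ⟨i, hi, hst'⟩ := exists_index_statAt hc hδ hθδ hX hst
  have h0 : 0 < δ := (isSuccLimit_of_aleph0_lt_cof hδ).bot_lt
  obtain ⟨s, -, hs, -, hR, y, hy, h1, h2⟩ := exists_omega_chain hδ
    (R := fun η η' ↦ StatAt {ε | ε ∈ X ∧ η ≤ c ε i ∧ c ε i < η'} δ) (fun η hη ↦ by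
      obtain ⟨η', hη', h⟩ := exists_statAt_Ico hc hδ hX hi (hst' η hη)
      obtain ⟨ε, ⟨-, h1, h2⟩, -⟩ := h.unbddAt (isSuccLimit_of_aleph0_lt_cof hδ) 0 h0
      exact ⟨η', hη', h1.trans_lt h2, h⟩) h0
  exact ⟨i, hi, s, hs, hR, y, hy, h1, h2⟩

end Splitting

/-- The index of the block of the sequence `s` that contains `x`. -/
noncomputable def block (s : ℕ → Ordinal.{u}) (x : Ordinal.{u}) : ℕ :=
  sInf {j | x < s (j + 1)}

theorem block_eq {s : ℕ → Ordinal.{u}} (hs : Monotone s) {x : Ordinal.{u}} {n : ℕ}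
    (h1 : s n ≤ x) (h2 : x < s (n + 1)) : block s x = n := by
  refine le_antisymm (Nat.sInf_le h2) (le_csInf ⟨n, h2⟩ fun j hj ↦ ?_)
  by_contra! hjn
  exact ((hs hjn).trans h1).not_gt hj

/-- The only use of λ ≥ 2^ℵ₀: one ordinal below λ codes a function ω → ω. -/
theorem exists_decoding (hl : (2 : Cardinal.{u}) ^ (ℵ₀ : Cardinal.{u}) ≤ l) :
    ∃ d : Ordinal.{u} → ℕ → ℕ, ∀ K, ∃ o < l.ord, d o = K := by
  have h : Cardinal.lift.{u + 1} #(ℕ → ℕ) ≤ Cardinal.lift.{0} #(Iio l.ord) := by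
    rw [Cardinal.mk_Iio_ordinal, card_ord, Cardinal.lift_lift]
    have : #(ℕ → ℕ) = (2 : Cardinal.{0}) ^ (ℵ₀ : Cardinal.{0}) := by
      simp
    rw [this]
    calc Cardinal.lift.{u + 1} ((2 : Cardinal.{0}) ^ (ℵ₀ : Cardinal.{0}))
        = Cardinal.lift.{u + 1} ((2 : Cardinal.{u}) ^ (ℵ₀ : Cardinal.{u})) := by simp
      _ ≤ Cardinal.lift.{u + 1} l := Cardinal.lift_le.2 hl
  obtain ⟨F⟩ := Cardinal.lift_mk_le'.1 h
  refine ⟨fun o ↦ if ho : o ∈ Iio l.ord then Function.invFun F ⟨o, ho⟩ else 0, fun K ↦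
    ⟨F K, (F K).2, ?_⟩⟩
  exact (dif_pos (F K).2).trans (Function.leftInverse_invFun F.injective K)

/-- Coloring for arbitrary `S` when `l` is at least the continuum. -/
theorem exists_coloring_of_continuum_le (hl : (2 : Cardinal.{u}) ^ (ℵ₀ : Cardinal.{u}) ≤ l)
    {θ κ : Cardinal.{u}} (hθ : ℵ₀ ≤ θ) (hθκ : θ < κ) (hκl : κ < l) {S : Set Ordinal.{u}}
    (hS : ∀ ε ∈ S, ε.cof = θ) :
    ∃ H : Ordinal.{u} → Ordinal.{u} → Ordinal.{u} → Ordinal.{u} → ℕ,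
      ∀ δ, l.ord < δ → δ.cof = κ → StatAt S δ →
        ∃ a < δ, ∃ b < δ, ∃ c < δ, ∀ n, StatAt {ε | ε ∈ S ∧ H a b c ε = n} δ := by
  obtain ⟨c, hc⟩ := exists_isCofinalSystem hθ
  obtain ⟨d, hd⟩ := exists_decoding hl
  -- The sequence `t y` depends on y alone, so the colouring can replace the unknown splitting
  -- sequence by a thinning of `t y`.
  have hseq : ∀ y : Ordinal.{u}, ∃ t : ℕ → Ordinal.{u},
      (∃ s : ℕ → Ordinal.{u}, (∀ n, s n < y) ∧ ∀ z < y, ∃ n, z < s n) →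
      (∀ n, t n < y) ∧ ∀ z < y, ∃ n, z < t n := by
    intro y
    by_cases h : ∃ s : ℕ → Ordinal.{u}, (∀ n, s n < y) ∧ ∀ z < y, ∃ n, z < s n
    · obtain ⟨s, hs⟩ := h
      exact ⟨s, fun _ ↦ hs⟩
    · exact ⟨fun _ ↦ 0, fun h' ↦ (h h').elim⟩
  choose t ht using hseq
  refine ⟨fun i y o ε ↦ block (t y ∘ d o) (c ε i), fun δ hlδ hδκ hst ↦ ?_⟩
  have hδ : ℵ₀ < δ.cof := hδκ ▸ hθ.trans_lt hθκ
  obtain ⟨i, hi, s, hs, hsst, y, hy, hsy, hys⟩ := exists_splitting hc hδ (hδκ ▸ hθκ) hS hst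
  obtain ⟨ht1, ht2⟩ := ht y ⟨s, hsy, hys⟩
  have hstep : ∀ k, ∃ k', StatAt {ε | ε ∈ S ∧ t y k ≤ c ε i ∧ c ε i < t y k'} δ := by
    intro k
    obtain ⟨n, hn⟩ := hys _ (ht1 k)
    obtain ⟨k', hk'⟩ := ht2 _ (hsy (n + 1))
    exact ⟨k', (hsst n).mono fun ε hε ↦ ⟨hε.1, hn.le.trans hε.2.1, hε.2.2.trans hk'⟩⟩
  choose F hF using hstep
  -- The thinning is chosen so that each interval between consecutive terms contains a whole block
  -- of the splitting sequence.
  obtain ⟨o, ho, hoK⟩ := hd fun n ↦ F^[n] 0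
  have hblock : ∀ n, StatAt {ε | ε ∈ S ∧ (t y ∘ d o) n ≤ c ε i ∧ c ε i < (t y ∘ d o) (n + 1)} δ := by
    intro n
    simp only [Function.comp, hoK, Function.iterate_succ_apply']
    exact hF _
  have hmono : StrictMono (t y ∘ d o) := strictMono_nat_of_lt_succ fun n ↦ by
    have hlim := isSuccLimit_of_aleph0_lt_cof hδ
    obtain ⟨ε, ⟨-, h1, h2⟩, -⟩ := (hblock n).unbddAt hlim 0 hlim.bot_lt
    exact h1.trans_lt h2
  refine ⟨i, hi.trans ((ord_lt_ord.2 (hθκ.trans hκl)).trans hlδ), y, hy, o, ho.trans hlδ,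
    fun n ↦ (hblock n).mono fun ε hε ↦ ⟨hε.1, block_eq hmono.monotone hε.2.1 hε.2.2⟩⟩

end

/-! ### Collapsing a coherent stage; the colouring of the full cofinality set -/

section

variable {l : Cardinal.{u}} {g : Ordinal.{u} → Ordinal.{u} → Ordinal.{u}}

/-- The rank of `ε` under the relation `β ∈ listed g ε ν`. -/
noncomputable def rank (g : Ordinal.{u} → Ordinal.{u} → Ordinal.{u}) (ν ε : Ordinal.{u}) :
    Ordinal.{u} :=
  ⨆ β : listed g ε ν, Order.succ (rank g ν β.1)
termination_by ε
decreasing_by exact β.2.1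

theorem small_listed (g : Ordinal.{u} → Ordinal.{u} → Ordinal.{u}) (ε ν : Ordinal.{u}) :
    Small.{u} (listed g ε ν) :=
  have h : listed g ε ν ⊆ Iio ε := fun _ hx ↦ hx.1
  small_subset h

theorem rank_lt {ε β ν : Ordinal.{u}} (h : β ∈ listed g ε ν) : rank g ν β < rank g ν ε := by
  have := small_listed g ε ν
  rw [rank.eq_1 g ν ε]
  exact (Order.lt_succ _).trans_le
    (le_ciSup (f := fun β : listed g ε ν ↦ Order.succ (rank g ν β.1)) (bddAbove_of_small) ⟨β, h⟩)

theorem exists_le_rank {ε ξ ν : Ordinal.{u}} (h : ξ < rank g ν ε) :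
    ∃ β ∈ listed g ε ν, ξ ≤ rank g ν β := by
  rw [rank] at h
  obtain ⟨β, hβ⟩ := exists_lt_of_lt_ciSup' h
  exact ⟨β, β.2, Order.lt_succ_iff.1 hβ⟩

theorem cof_eq_of_strictMonoOn {ζ δ : Ordinal.{u}} {w : Ordinal.{u} → Ordinal.{u}}
    (hw : StrictMonoOn w (Iio ζ)) (hwδ : ∀ ξ < ζ, w ξ < δ) (hu : ∀ y < δ, ∃ ξ < ζ, y ≤ w ξ) :
    ζ.cof = δ.cof := by
  have h := Order.cof_congr_of_strictMono (f := fun ξ : Iio ζ ↦ (⟨w ξ, hwδ ξ ξ.2⟩ : Iio δ))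
    (fun ξ ξ' h ↦ hw ξ.2 ξ'.2 h) (fun y ↦
      let ⟨ξ, hξ, hy⟩ := hu y y.2; ⟨_, ⟨⟨ξ, hξ⟩, rfl⟩, hy⟩)
  rwa [cof_Iio, cof_Iio, ← lift_cof, ← lift_cof, Cardinal.lift_inj] at h

section Coherent

variable {δ ν : Ordinal.{u}}

theorem CoherentAt.rank_strictMonoOn (h : CoherentAt g δ ν) :
    StrictMonoOn (rank g ν) (listed g δ ν) := fun β hβ β' hβ' hlt ↦
  rank_lt (by rw [h.eq_inter β' hβ']; exact ⟨hβ, hlt⟩)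

/-- Ranks have no gaps: by coherence, the least element of rank at least ξ has rank exactly ξ. Hence
rank is the transitive collapse of the stage. -/
theorem CoherentAt.exists_rank_eq (h : CoherentAt g δ ν) {ξ : Ordinal.{u}} (hξ : ξ < rank g ν δ) :
    ∃ β ∈ listed g δ ν, rank g ν β = ξ := by
  obtain ⟨hβ, hle⟩ := csInf_mem (s := {β | β ∈ listed g δ ν ∧ ξ ≤ rank g ν β}) (exists_le_rank hξ)
  refine ⟨_, hβ, hle.antisymm' (not_lt.1 fun hlt ↦ ?_)⟩
  obtain ⟨β', hβ', hle'⟩ := exists_le_rank hlt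
  have hmem := hβ'
  rw [h.eq_inter _ hβ] at hmem
  have hmem' : β' ∈ {β | β ∈ listed g δ ν ∧ ξ ≤ rank g ν β} := ⟨hmem.1, hle'⟩
  exact (csInf_le' hmem').not_gt hβ'.1

theorem CoherentAt.rank_lt_ord (h : CoherentAt g δ ν) (hν : ν < l.ord) : rank g ν δ < l.ord := by
  choose! w hw hwr using fun ξ ↦ h.exists_rank_eq (ξ := ξ)
  rw [lt_ord, ← Cardinal.lift_lt.{u, u + 1}, ← Cardinal.mk_Iio_ordinal]
  refine (mk_le_of_injective (f := fun ξ : Iio (rank g ν δ) ↦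
    (⟨w ξ, hw ξ ξ.2⟩ : listed g δ ν)) fun ξ ξ' hξ ↦ Subtype.ext ?_).trans_lt (mk_listed_lt hν)
  rw [← hwr ξ ξ.2, ← hwr ξ' ξ'.2, show w ξ = w ξ' from congrArg Subtype.val hξ]

/-- The increasing enumeration of a coherent stage of the listing of `δ`. -/
structure IsEnum (g : Ordinal.{u} → Ordinal.{u} → Ordinal.{u}) (δ ν : Ordinal.{u})
    (w : Ordinal.{u} → Ordinal.{u}) : Prop where
  mem : ∀ ξ < rank g ν δ, w ξ ∈ listed g δ ν
  rank_eq : ∀ ξ < rank g ν δ, rank g ν (w ξ) = ξ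
  eq_rank : ∀ β ∈ listed g δ ν, w (rank g ν β) = β
  strictMonoOn : StrictMonoOn w (Iio (rank g ν δ))
  cofinal : ∀ y < δ, ∃ ξ < rank g ν δ, y < w ξ

theorem CoherentAt.exists_isEnum (h : CoherentAt g δ ν) : ∃ w, IsEnum g δ ν w := by
  choose! w hw hwr using fun ξ ↦ h.exists_rank_eq (ξ := ξ)
  have heq : ∀ β ∈ listed g δ ν, w (rank g ν β) = β := fun β hβ ↦
    h.rank_strictMonoOn.injOn (hw _ (rank_lt hβ)) hβ (hwr _ (rank_lt hβ))
  refine ⟨w, hw, hwr, heq, fun ξ hξ ξ' hξ' hlt ↦ ?_, fun y hy ↦ ?_⟩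
  · rw [← h.rank_strictMonoOn.lt_iff_lt (hw ξ hξ) (hw ξ' hξ'), hwr ξ hξ, hwr ξ' hξ']
    exact hlt
  · obtain ⟨a, ha, h1, -⟩ := h.unbddAt y hy
    exact ⟨_, rank_lt ha, by rwa [heq a ha]⟩

variable {w : Ordinal.{u} → Ordinal.{u}}

theorem IsEnum.cof_rank (hw : IsEnum g δ ν w) : (rank g ν δ).cof = δ.cof :=
  cof_eq_of_strictMonoOn hw.strictMonoOn (fun ξ hξ ↦ (hw.mem ξ hξ).1) fun y hy ↦
    let ⟨ξ, hξ, h⟩ := hw.cofinal y hy; ⟨ξ, hξ, h.le⟩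

theorem CoherentAt.cof_rank_eq (h : CoherentAt g δ ν) {ε : Ordinal.{u}}
    (hε : ε ∈ listed g δ ν) (hU : UnbddAt (listed g δ ν) ε) : (rank g ν ε).cof = ε.cof := by
  have hcoh : CoherentAt g ε ν := by
    have heq := h.eq_inter ε hε
    refine ⟨fun y hy ↦ ?_, fun β hβ ↦ ?_, fun β hβ hcof hUβ ↦ ?_⟩
    · obtain ⟨a, ha, h1, h2⟩ := hU y hy
      exact ⟨a, heq ▸ ⟨ha, h2⟩, h1, h2⟩
    · rw [heq] at hβ ⊢
      rw [h.eq_inter β hβ.1, inter_assoc, Iio_inter_Iio, min_eq_right hβ.2.out.le]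
    · rw [heq] at hUβ ⊢
      exact ⟨h.mem_of_unbddAt β (hβ.trans hε.1) hcof (hUβ.mono inter_subset_left), hβ⟩
  obtain ⟨w, hw⟩ := hcoh.exists_isEnum
  exact hw.cof_rank

/-- Push a club of the collapse up to δ along the enumeration. A limit of cofinality θ > ω belongs
to the stage by coherence, and its rank is a limit of the club with the same cofinality. -/
theorem statAt_cof_rank (h : CoherentAt g δ ν) (hδ : ℵ₀ < δ.cof) {θ : Cardinal.{u}} (hθ : ℵ₀ < θ)
    (hst : StatAt {ε | ε.cof = θ} δ) : StatAt {ξ | ξ.cof = θ} (rank g ν δ) := by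
  intro D hD
  obtain ⟨w, hw⟩ := h.exists_isEnum
  have hU : UnbddAt (w '' (D ∩ Iio (rank g ν δ))) δ := by
    intro y hy
    obtain ⟨ξ, hξ, hyξ⟩ := hw.cofinal y hy
    obtain ⟨d, hd, h1, h2⟩ := hD.1 ξ hξ
    exact ⟨w d, ⟨d, ⟨hd, h2⟩, rfl⟩, hyξ.trans (hw.strictMonoOn hξ h2 h1), (hw.mem d h2).1⟩
  obtain ⟨ε, hεθ, hεδ, hεU⟩ := hst _ (clubAt_setOf_unbddAt hδ hU)
  have hUl : UnbddAt (listed g δ ν) ε := hεU.mono (by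
    rintro _ ⟨d, hd, rfl⟩
    exact hw.mem d hd.2)
  have hεω : ℵ₀ < ε.cof := hθ.trans_eq hεθ.out.symm
  have hεmem := h.mem_of_unbddAt ε hεδ hεω hUl
  have hcof := h.cof_rank_eq hεmem hUl
  have hrδ := rank_lt hεmem
  refine ⟨rank g ν ε, hcof.trans hεθ, hrδ, hD.2 _ hrδ ?_ fun y hy ↦ ?_⟩
  · intro h0
    rw [h0, cof_zero] at hcof
    exact not_lt_zero (hcof ▸ hεω)
  · have hyε : w y < ε := by
      rw [← hw.eq_rank ε hεmem]
      exact hw.strictMonoOn (hy.trans hrδ) hrδ hy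
    obtain ⟨_, ⟨d, hd, rfl⟩, h1, h2⟩ := hεU _ hyε
    refine ⟨d, hd.1, (hw.strictMonoOn.lt_iff_lt (hy.trans hrδ) hd.2).1 h1, ?_⟩
    rw [← hw.eq_rank ε hεmem] at h2
    exact (hw.strictMonoOn.lt_iff_lt hd.2 hrδ).1 h2

theorem statAt_of_statAt_rank (h : CoherentAt g δ ν) (hδ : ℵ₀ < δ.cof) {θ : Cardinal.{u}}
    (hθ : ℵ₀ < θ) {P : Ordinal.{u} → Prop} (hst : StatAt {ξ | ξ.cof = θ ∧ P ξ} (rank g ν δ)) :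
    StatAt {ε | ε.cof = θ ∧ P (rank g ν ε)} δ := by
  intro D hD
  obtain ⟨w, hw⟩ := h.exists_isEnum
  have hζ : ℵ₀ < (rank g ν δ).cof := by rwa [hw.cof_rank]
  -- Indices ξ for which D has a point below w(ξ) and at or above all earlier values. If ξ is a
  -- limit of `W`, the supremum ε of the earlier values is a limit of `D`; when cf(ξ) = θ, coherence
  -- puts ε in the stage with rank ξ.
  let W : Set Ordinal.{u} := {ξ | ξ < rank g ν δ ∧ ∃ d ∈ D, d < w ξ ∧ ∀ ξ' < ξ, w ξ' ≤ d}
  have hW : UnbddAt W (rank g ν δ) := by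
    intro y hy
    obtain ⟨d, hd, h1, h2⟩ := hD.1 (w y) (hw.mem y hy).1
    obtain ⟨hm1, hm2⟩ := csInf_mem (s := {ξ | ξ < rank g ν δ ∧ d < w ξ}) (hw.cofinal d h2)
    refine ⟨_, ⟨hm1, d, hd, hm2, fun ξ' hξ' ↦ not_lt.1 fun hlt ↦ ?_⟩, ?_, hm1⟩
    · have hmem : ξ' ∈ {ξ | ξ < rank g ν δ ∧ d < w ξ} := ⟨hξ'.trans hm1, hlt⟩
      exact (csInf_le' hmem).not_gt hξ'
    · exact (hw.strictMonoOn.lt_iff_lt hy hm1).1 (h1.trans hm2)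
  obtain ⟨ξ, ⟨hξθ, hξP⟩, hξ, hξW⟩ := hst _ (clubAt_setOf_unbddAt hζ hW)
  have hξlim : Order.IsSuccLimit ξ := isSuccLimit_of_aleph0_lt_cof (hξθ ▸ hθ)
  set ε := sInf {x | ∀ ξ' < ξ, w ξ' < x} with hε
  have hwξ : w ξ ∈ {x | ∀ ξ' < ξ, w ξ' < x} := fun ξ' hξ' ↦
    hw.strictMonoOn (hξ'.trans hξ) hξ hξ'
  have hlow : ∀ ξ' < ξ, w ξ' < ε := csInf_mem (s := {x | ∀ ξ' < ξ, w ξ' < x}) ⟨_, hwξ⟩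
  have hεξ : ε ≤ w ξ := csInf_le' hwξ
  have hεδ : ε < δ := hεξ.trans_lt (hw.mem ξ hξ).1
  have hup : ∀ y < ε, ∃ ξ' < ξ, y ≤ w ξ' := fun y hy ↦ by
    by_contra! hcon
    have hmem : y ∈ {x | ∀ ξ' < ξ, w ξ' < x} := hcon
    exact (csInf_le' hmem).not_gt hy
  have hcof : ξ.cof = ε.cof := cof_eq_of_strictMonoOn
    (hw.strictMonoOn.mono (Iio_subset_Iio hξ.le)) hlow hup
  have hDε : UnbddAt D ε := fun y hy ↦ by
    obtain ⟨ξ₁, h1, h2⟩ := hup y hy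
    obtain ⟨ξ₂, ⟨-, d, hd, h3, h4⟩, h5, h6⟩ := hξW (Order.succ ξ₁) (hξlim.succ_lt h1)
    refine ⟨d, hd, h2.trans_lt (lt_of_lt_of_le ?_ (h4 _ h5)), h3.trans (hlow _ h6)⟩
    exact hw.strictMonoOn (h1.trans hξ) ((hξlim.succ_lt h1).trans hξ) (Order.lt_succ ξ₁)
  have hlε : UnbddAt (listed g δ ν) ε := fun y hy ↦ by
    obtain ⟨ξ₁, h1, h2⟩ := hup y hy
    have h3 := hξlim.succ_lt h1
    exact ⟨w (Order.succ ξ₁), hw.mem _ (h3.trans hξ),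
      h2.trans_lt (hw.strictMonoOn (h1.trans hξ) (h3.trans hξ) (Order.lt_succ ξ₁)), hlow _ h3⟩
  have hεω : ℵ₀ < ε.cof := hcof ▸ hξθ ▸ hθ
  have hεmem := h.mem_of_unbddAt ε hεδ hεω hlε
  have hrank : rank g ν ε = ξ := by
    have hrδ := rank_lt hεmem
    refine le_antisymm ?_ (not_lt.1 fun hlt ↦ ?_)
    · rw [← hw.strictMonoOn.le_iff_le hrδ hξ, hw.eq_rank ε hεmem]
      exact hεξ
    · have := hlow _ hlt
      rw [hw.eq_rank ε hεmem] at this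
      exact this.false
  refine ⟨ε, ⟨hcof ▸ hξθ, hrank ▸ hξP⟩, hεδ, hD.2 ε hεδ ?_ hDε⟩
  intro h0
  rw [h0, cof_zero] at hεω
  exact not_lt_zero hεω

end Coherent

/-- Coloring for the full set of ordinals of cofinality `θ`. -/
theorem exists_coloring_cofSet (g : Ordinal.{u} → Ordinal.{u} → Ordinal.{u}) {θ κ : Cardinal.{u}}
    (hθ : ℵ₀ < θ) (hθκ : θ < κ) :
    ∃ H : Ordinal.{u} → Ordinal.{u} → Ordinal.{u} → ℕ,
      ∀ δ, l.ord < δ → δ.cof = κ → StatAt {ε | ε.cof = θ} δ → ∀ ν < l.ord, CoherentAt g δ ν →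
        ∃ a < δ, ∀ n, StatAt {ε | ε.cof = θ ∧ H ν a ε = n} δ := by
  obtain ⟨c, hc⟩ := exists_isCofinalSystem hθ.le
  -- The colouring is chosen for each ζ before any δ is given, so knowing ζ is enough to recover it.
  have hcol : ∀ ζ : Ordinal.{u}, ∃ h : Ordinal.{u} → ℕ, ζ.cof = κ → StatAt {ξ | ξ.cof = θ} ζ →
      ∀ n, StatAt {ξ | ξ.cof = θ ∧ h ξ = n} ζ := by
    intro ζ
    by_cases hζ : ζ.cof = κ ∧ StatAt {ξ | ξ.cof = θ} ζ
    · obtain ⟨i, -, s, hs, hst, -⟩ := exists_splitting hc (hζ.1 ▸ hθ.trans hθκ) (hζ.1 ▸ hθκ)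
        (fun ε hε ↦ hε) hζ.2
      exact ⟨fun ξ ↦ block s (c ξ i), fun _ _ n ↦ (hst n).mono fun ε hε ↦
        ⟨hε.1, block_eq hs.monotone hε.2.1 hε.2.2⟩⟩
    · exact ⟨fun _ ↦ 0, fun h1 h2 ↦ (hζ ⟨h1, h2⟩).elim⟩
  choose h hh using hcol
  refine ⟨fun ν ζ ε ↦ h ζ (rank g ν ε), fun δ hlδ hδκ hst ν hν hcoh ↦
    ⟨rank g ν δ, (hcoh.rank_lt_ord hν).trans hlδ, fun n ↦ ?_⟩⟩
  have hδ : ℵ₀ < δ.cof := hδκ ▸ hθ.trans hθκ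
  obtain ⟨w, hw⟩ := hcoh.exists_isEnum
  exact statAt_of_statAt_rank hcoh hδ hθ (P := fun ξ ↦ h (rank g ν δ) ξ = n)
    (hh _ (hw.cof_rank.trans hδκ) (statAt_cof_rank hcoh hδ hθ hst) n)

theorem exists_listing (l : Cardinal.{u}) : ∃ g : Ordinal.{u} → Ordinal.{u} → Ordinal.{u},
    ∀ ε < (Order.succ l).ord, ∀ β < ε, ∃ i < l.ord, g ε i = β := by
  have h : ∀ ε : Ordinal.{u}, ∃ f : Ordinal.{u} → Ordinal.{u},
      ε < (Order.succ l).ord → ∀ β < ε, ∃ i < l.ord, f i = β := by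
    intro ε
    by_cases hε : ε < (Order.succ l).ord
    · have hle : #(Iio ε) ≤ #(Iio l.ord) := by
        rw [Cardinal.mk_Iio_ordinal, Cardinal.mk_Iio_ordinal, Cardinal.lift_le, card_ord]
        exact Order.lt_succ_iff.1 (lt_ord.1 hε)
      obtain ⟨F⟩ := hle
      let F' : Iio ε → Ordinal.{u} := fun β ↦ F β
      have hF' : Function.Injective F' := Subtype.val_injective.comp F.injective
      refine ⟨Function.extend F' (fun β ↦ β.1) id, fun _ β hβ ↦ ⟨F' ⟨β, hβ⟩, (F ⟨β, hβ⟩).2, ?_⟩⟩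
      exact hF'.extend_apply _ _ _
    · exact ⟨id, fun h ↦ (hε h).elim⟩
  choose g hg using h
  exact ⟨g, hg⟩

end

end ClubGuess

/-! ### The two cases of the theorem -/

theorem theorem1p1 (l θ₁ θ : Cardinal.{u})
    (hl : l.IsRegular) (hθ₁l : Order.succ θ₁ < l) (hθθ₁ : θ ≤ θ₁) (hθ : θ.IsRegular)
    (hθω₁ : ℵ₁ < θ)
    (S : Set Ordinal.{u})
    (hS : S ⊆ ClubGuess.cofSet (Order.succ l).ord θ)
    (hSstat : ClubGuess.IsStationaryIn S (Order.succ l).ord)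
    (hS₁ : ClubGuess.IsStationaryIn
      (ClubGuess.reflectionSet S (Order.succ l).ord (Order.succ θ₁)) (Order.succ l).ord) :
    ((2 : Cardinal.{u}) ^ (ℵ₀ : Cardinal.{u}) ≤ l →
      ClubGuess.HasGuessingClubs l S (l.ord ^ (ω : Ordinal.{u}) * (Order.succ θ₁).ord)) ∧
    (S = ClubGuess.cofSet (Order.succ l).ord θ →
      ClubGuess.HasGuessingClubs l S (l.ord ^ (ω : Ordinal.{u}) * (Order.succ θ₁).ord)) := by
  have hθω : ℵ₀ < θ := aleph0_lt_aleph_one.trans hθω₁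
  have hθκ : θ < Order.succ θ₁ := Order.lt_succ_of_le hθθ₁
  have hL : Order.IsSuccLimit (Order.succ l).ord :=
    isSuccLimit_ord (hl.1.trans (Order.le_succ l))
  rw [ClubGuess.isStationaryIn_iff hL] at hS₁
  obtain ⟨g, hg⟩ := ClubGuess.exists_listing l
  -- The clubs built have order type at most λ^ω already.
  have hγ : l.ord ^ (ω : Ordinal.{u}) ≤ l.ord ^ (ω : Ordinal.{u}) * (Order.succ θ₁).ord :=
    le_mul_left _ (ord_pos.2 (hθω.trans hθκ).pos)
  refine ⟨fun hc ↦ ?_, fun hSeq ↦ ?_⟩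
  · obtain ⟨H, hH⟩ := ClubGuess.exists_coloring_of_continuum_le hc hθω.le hθκ hθ₁l
      (fun ε hε ↦ (hS hε).2)
    exact ClubGuess.hasGuessingClubs_of_coloring hl (hθω.trans hθκ) hθ₁l hθω hS hS₁ hg
      (fun _ ↦ H) (fun δ _ hlδ hδκ hst _ _ _ ↦ hH δ hlδ hδκ hst) hγ
  · obtain ⟨H, hH⟩ := ClubGuess.exists_coloring_cofSet (l := l) g hθω hθκ
    refine ClubGuess.hasGuessingClubs_of_coloring hl (hθω.trans hθκ) hθ₁l hθω hS hS₁ hg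
      (fun ν a _ _ ↦ H ν a) (fun δ hδL hlδ hδκ hst ν hν hcoh ↦ ?_) hγ
    obtain ⟨a, ha, h⟩ := hH δ hlδ hδκ (hst.mono fun ε hε ↦ (hS hε).2) ν hν hcoh
    have h0 : 0 < δ := bot_lt_of_lt hlδ
    -- The two remaining parameters are dummies.
    refine ⟨a, ha, 0, h0, 0, h0, fun n D hD ↦ ?_⟩
    obtain ⟨ε, ⟨h1, h2⟩, h3, h4⟩ := h n D hD
    exact ⟨ε, ⟨hSeq ▸ ⟨h3.trans hδL, h1⟩, h2⟩, h3, h4⟩
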